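/- Let $n\ge 0$ be an integer and $u<1$ a real number. For $(x,y,z)$ in the closed unit ball of $\mathbb R^3$ let $$\rho=\tfrac12\begin{pmatrix}1+z&x-iy\\x+iy&1-z\end{pmatrix},\qquad q_u(x,y,z)=\frac{\Gamma(\frac52-u)}{\pi^{3/2}\,\Gamma(1-u)\,(1-x^2-y^2-z^2)^u},$$ and let $\zeta_n(u)=\int_{x^2+y^2+z^2\le1}\rho^{\otimes n}\,q_u\,dx\,dy\,dz$, a $2^n\times2^n$ matrix with rows and columns indexed by the subsets of $[n]=\{1,\dots,n\}$ (the subset $I$ corresponds to the choice of the first row or column of the $k$-th factor $\rho$ for $k\in I$, and of the second one for $k\notin I$). (a) With $a=|I\cap J|$ and $b=|[n]\setminus(I\cup J)|$, the $(I,J)$ entry of $\zeta_n(u)$ is $0$ if $|J\setminus I|\ne|I\setminus J|$, and otherwise it is $$\Big(\frac{n-a-b}2\Big)!\;\frac1{2^n}\,\frac{\Gamma(\frac52-u)\,\Gamma(2+\frac n2+\frac a2-\frac b2-u)\,\Gamma(2+\frac n2+\frac b2-\frac a2-u)}{\Gamma(\frac52+\frac n2-u)\,\Gamma(2+\frac n2-u)\,\Gamma(2+\frac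 n2-\frac a2-\frac b2-u)}.$$ (b) The eigenvalues of $\zeta_n(u)$ are exactly the numbers $$\lambda_d=\frac1{2^n}\,\frac{\Gamma(\frac52-u)\,\Gamma(2+n-d-u)\,\Gamma(1+d-u)}{\Gamma(\frac52+\frac n2-u)\,\Gamma(2+\frac n2-u)\,\Gamma(1-u)},\qquad d=0,1,\dots,\lfloor n/2\rfloor;$$ these are pairwise distinct, and the eigenspace of $\lambda_d$ has dimension $\frac{(n-2d+1)^2}{n+1}\binom{n+1}d$. (c) Let $0\le d\le s\le n-d$, and let $P$ be a ballot path from $(0,0)$ to $(n,n-2d)$, that is, a lattice path with steps $(1,1)$ (up) and $(1,-1)$ (down), labelled $1,\dots,n$ in order, which never goes below the $x$-axis. Let $A$ be the set of labels of the first $d$ up-steps of $P$ and $B$ the set of labels of its $d$ down-steps. Put $$v_{d,s}(P)=\sum_{X\subseteq A}\ \sum_{Y\subseteq[n]\setminus(A\cup B),\ |Y|=s-d}(-1)^{|X|}\,e_{X\cup X'\cup Y},$$ where $e_T$ is the standard unit vector indexed by $T\subseteq[n]$ and $X'$ arises from $B$ by removing, for each $i$ such that the $i$-th largest element of $A$ lies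 in $X$, the $i$-th largest element of $B$. Then $v_{d,s}(P)$ is an eigenvector of $\zeta_n(u)$ for the eigenvalue $\lambda_d$. For each $d\in\{0,\dots,\lfloor n/2\rfloor\}$ the vectors $v_{d,s}(P)$, with $d\le s\le n-d$ and $P$ a ballot path from $(0,0)$ to $(n,n-2d)$, span the eigenspace of $\lambda_d$. The family of all vectors $v_{d,s}(P)$, indexed by the triples $(d,s,P)$ with $0\le d\le s\le n-d$ and $P$ a ballot path from $(0,0)$ to $(n,n-2d)$, is linearly independent and spans $\mathbb C^{2^n}$. -/

import Mathlib

open scoped Nat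

noncomputable section

namespace BayesDensity

/-- The two-level density matrix `ρ = ½ [[1 + z, x - iy], [x + iy, 1 - z]]`, written as a function
of a row and a column label. The label `true` stands for the first row (column), the label `false`
for the second one. -/
def rho (x y z : ℝ) : Bool → Bool → ℂ
  | true, true => (1 + z) / 2
  | true, false => (x - Complex.I * y) / 2
  | false, true => (x + Complex.I * y) / 2
  | false, false => (1 - z) / 2

/-- The `n`-fold tensor (Kronecker) power of `ρ`. Rows and columns are indexed by the subsets of
`[n]`: the subset `I` stands for the string of labels whose `k`-th letter says whether `k ∈ I`.
The set `[n]` is `Fin n` throughout, so that labels are shifted down by one. -/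
def rhoPow (n : ℕ) (x y z : ℝ) : Matrix (Finset (Fin n)) (Finset (Fin n)) ℂ :=
  fun I J => ∏ k : Fin n, rho x y z (decide (k ∈ I)) (decide (k ∈ J))

/-- The probability density `q(u)` on the unit ball. -/
def prior (u x y z : ℝ) : ℝ :=
  Real.Gamma (5 / 2 - u) /
    (Real.pi ^ (3 / 2 : ℝ) * Real.Gamma (1 - u) * (1 - x ^ 2 - y ^ 2 - z ^ 2) ^ u)

/-- The closed unit ball `x² + y² + z² ≤ 1` of `ℝ³`. -/
def unitBall : Set (ℝ × ℝ × ℝ) :=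
  {w | w.1 ^ 2 + w.2.1 ^ 2 + w.2.2 ^ 2 ≤ 1}

/-- The Bayesian density matrix `ζ_n(u)`: the entrywise average of the `n`-fold tensor power of
`ρ` with respect to the density `q(u)` on the unit ball. -/
def zeta (n : ℕ) (u : ℝ) : Matrix (Finset (Fin n)) (Finset (Fin n)) ℂ :=
  fun I J => ∫ w in unitBall,
    rhoPow n w.1 w.2.1 w.2.2 I J * ((prior u w.1 w.2.1 w.2.2 : ℝ) : ℂ)

/-- The explicit entries `Z_{IJ}`, in terms of the number `a` of elements in both `I` and `J`
and the number `b` of elements in neither. If `|J \ I| = |I \ J|`, then `n - a - b` is even. -/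
def entry (n : ℕ) (u : ℝ) (I J : Finset (Fin n)) : ℝ :=
  let a := (I ∩ J).card
  let b := ((I ∪ J)ᶜ).card
  (if (J \ I).card = (I \ J).card then 1 else 0) * (((n - a - b) / 2)! : ℝ) *
    (1 / 2 ^ n *
      (Real.Gamma (5 / 2 - u) * Real.Gamma (2 + n / 2 + a / 2 - b / 2 - u) *
        Real.Gamma (2 + n / 2 + b / 2 - a / 2 - u)) /
      (Real.Gamma (5 / 2 + n / 2 - u) * Real.Gamma (2 + n / 2 - u) *
        Real.Gamma (2 + n / 2 - a / 2 - b / 2 - u)))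

/-- The numbers `λ_d`. -/
def eigval (n : ℕ) (u : ℝ) (d : ℕ) : ℝ :=
  1 / 2 ^ n *
    (Real.Gamma (5 / 2 - u) * Real.Gamma (2 + n - d - u) * Real.Gamma (1 + d - u)) /
    (Real.Gamma (5 / 2 + n / 2 - u) * Real.Gamma (2 + n / 2 - u) * Real.Gamma (1 - u))

/-- The height after `k` steps of the lattice path from the origin whose `i`-th step is the
up-step `(1, 1)` if `p i = true` and the down-step `(1, -1)` if `p i = false`. -/
def height {n : ℕ} (p : Fin n → Bool) (k : ℕ) : ℤ :=
  ∑ i : Fin n with i.val < k, if p i = true then 1 else -1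

/-- The ballot paths from `(0, 0)` to `(n, n - 2d)`: they never go below the `x`-axis. -/
def BallotPath (n d : ℕ) : Type :=
  {p : Fin n → Bool // (∀ k ≤ n, 0 ≤ height p k) ∧ height p n = (n : ℤ) - 2 * d}

/-- `A_P`: the labels of the first `d` up-steps. -/
def BallotPath.upSet {n d : ℕ} (P : BallotPath n d) : Finset (Fin n) :=
  {i | P.1 i = true ∧ (Finset.univ.filter fun j => j < i ∧ P.1 j = true).card < d}

/-- `B_P`: the labels of the down-steps. -/
def BallotPath.downSet {n d : ℕ} (P : BallotPath n d) : Finset (Fin n) :=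
  {i | P.1 i = false}

/-- The complement of `X ⊆ A` in `B`: remove from `B` its `i`-th largest element whenever the
`i`-th largest element of `A` is in `X`. An element is the `i`-th largest of a set
if exactly `i - 1` elements of the set exceed it. -/
def complIn {n : ℕ} (A B X : Finset (Fin n)) : Finset (Fin n) :=
  {b ∈ B | ∀ a ∈ X, (A.filter fun a' => a < a').card ≠ (B.filter fun b' => b < b').card}

/-- The vector `v_{d,s}(A, B) = ∑ (-1)^|X| e_{X ∪ X' ∪ Y}`, summed over all `X ⊆ A` and all
`Y ⊆ [n] \ (A ∪ B)` with `|Y| = s - d`, for `d ≤ s`. -/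
def vecAB {n : ℕ} (d s : ℕ) (A B : Finset (Fin n)) : Finset (Fin n) → ℂ :=
  ∑ X ∈ A.powerset, ∑ Y ∈ (A ∪ B)ᶜ.powersetCard (s - d),
    (-1 : ℂ) ^ X.card • Pi.single (X ∪ complIn A B X ∪ Y) (1 : ℂ)

/-- The vector `v_{d,s}(P) = v_{d,s}(A_P, B_P)`. -/
def vec {n d : ℕ} (s : ℕ) (P : BallotPath n d) : Finset (Fin n) → ℂ :=
  vecAB d s P.upSet P.downSet

/-- The triples `(d, s, P)` with `0 ≤ d ≤ s ≤ n - d` (so that `d ≤ n / 2`) and `P` a ballot path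
from `(0, 0)` to `(n, n - 2d)`. -/
abbrev Index (n : ℕ) : Type :=
  Σ d : Fin (n / 2 + 1), Set.Icc (d : ℕ) (n - d) × BallotPath n d

end BayesDensity

end

/-!
The proof has three independent ingredients.

*Integrals.* An entry of `ρ^{⊗n}` is a product of powers of `(1 ± z) / 2` and `(x ± iy) / 2`. Fubini
with the height `z` outermost, polar coordinates in the disc at height `z`, two Beta integrals and
the duplication formula give its integral against `(1 - r²)^{-u}` (`integral_prod_rho`). The factor
of the angular integral vanishes unless `|I \ J| = |J \ I|`.

*Eigenvectors.* The vector `v_{d,s}(A, B)` is a tensor product of `d` singlets, one for each pair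
consisting of the `i`-th elements of `A` and `B`, with the sum of the basis vectors of weight
`s - d` on the remaining `n - 2d` letters. On a singlet `ρ ⊗ ρ` is the scalar `det ρ = (1 - r²) / 4`.
Hence applying `ζ_n(u)` replaces `u` by `u - d` and `n` by `n - 2d`, and it remains to see that the vector
of all basis vectors of a given weight is an eigenvector of `ζ_{n-2d}(u - d)`
(`sum_integral_prod_rho`), which is Vandermonde's convolution in the form
`sum_choose_mul_choose_div_Gamma`.

*Completeness.* Test `v_{e,t}(Q)` against the functional that sums the coordinates at all supersets
of size `s` of the set of down-steps of a path `P`. The result is nonzero only if `t = s` and the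
down-steps of `P` meet each pair of `Q` exactly once. As each up-step of a pair precedes its
down-step, this makes the matrix of tests triangular, with nonzero diagonal, in the lexicographic
order of `d` and of the (reversed) sum of the labels of the down-steps (`linearIndependent_vec`).
The ballot numbers `C(n, d) - C(n, d - 1)` show that there are `2^n` vectors (`card_index`), so
they are a basis of eigenvectors, from which all eigenspaces can be read off
(`eigenspace_eq_span_image`).
-/

namespace BayesDensity

open MeasureTheory

/-! ### Integrals over a disc -/

/-- The Beta integral over `(0, c]`. -/
theorem integral_Ioc_rpow_mul_sub_rpow {s t c : ℝ} (hs : 0 < s) (ht : 0 < t) (hc : 0 < c) :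
    ∫ x in Set.Ioc 0 c, x ^ (s - 1) * (c - x) ^ (t - 1) =
      c ^ (s + t - 1) * (Real.Gamma s * Real.Gamma t / Real.Gamma (s + t)) := by
  have h := Complex.betaIntegral_scaled s t hc
  rw [Complex.betaIntegral_eq_Gamma_mul_div _ _ (by simpa) (by simpa)] at h
  rw [intervalIntegral.integral_of_le hc.le] at h
  rw [← Complex.ofReal_inj, ← integral_complex_ofReal]
  push_cast
  rw [Complex.ofReal_cpow hc.le, ← Complex.Gamma_ofReal, ← Complex.Gamma_ofReal,
    ← Complex.Gamma_ofReal]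
  push_cast
  rw [← h]
  refine setIntegral_congr_fun measurableSet_Ioc fun x hx => ?_
  rw [Complex.ofReal_cpow hx.1.le, Complex.ofReal_cpow (sub_nonneg.2 hx.2)]
  push_cast
  rfl

theorem integral_radial (m : ℕ) {u c : ℝ} (hu : u < 1) (hc : 0 < c) :
    ∫ r in Set.Ioi (0 : ℝ), r * (if r ^ 2 ≤ c then r ^ (2 * m) * (c - r ^ 2) ^ (-u) else 0) =
      c ^ (m + 1 - u) * (m ! * Real.Gamma (1 - u) / Real.Gamma (m + 2 - u)) / 2 := by
  have h := integral_comp_rpow_Ioi_of_pos (p := 2) two_pos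
    (g := fun t : ℝ => if t ≤ c then t ^ m * (c - t) ^ (-u) else 0)
  have h1 : ∫ y in Set.Ioi (0 : ℝ), (if y ≤ c then y ^ m * (c - y) ^ (-u) else 0) =
      c ^ (m + 1 - u) * (m ! * Real.Gamma (1 - u) / Real.Gamma (m + 2 - u)) := by
    have h2 := integral_Ioc_rpow_mul_sub_rpow (s := m + 1) (t := 1 - u) (c := c) (by positivity)
      (by linarith) hc
    rw [Real.Gamma_nat_eq_factorial] at h2
    rw [show (m : ℝ) + 1 - u = m + 1 + (1 - u) - 1 by ring,
      show (m : ℝ) + 2 - u = m + 1 + (1 - u) by ring, ← h2, ← Set.Ioi_inter_Iic,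
      ← setIntegral_indicator measurableSet_Iic]
    refine setIntegral_congr_fun measurableSet_Ioi fun x hx => ?_
    simp only [Set.indicator_apply, Set.mem_Iic]
    split_ifs
    · rw [add_sub_cancel_right, Real.rpow_natCast]
      congr 2; ring
    · rfl
  rw [h1] at h
  rw [← h, eq_div_iff two_ne_zero, ← integral_mul_const]
  refine setIntegral_congr_fun measurableSet_Ioi fun x hx => ?_
  simp only [smul_eq_mul]
  rw [show (2 : ℝ) - 1 = 1 by norm_num, Real.rpow_one, Real.rpow_two]
  split_ifs
  · rw [← pow_mul]; ring
  · simp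

theorem integral_angular (p q : ℕ) :
    ∫ θ in Set.Ioo (-Real.pi) Real.pi,
      (Real.cos θ - Complex.I * Real.sin θ : ℂ) ^ p * (Real.cos θ + Complex.I * Real.sin θ) ^ q =
      if p = q then ((2 * Real.pi : ℝ) : ℂ) else 0 := by
  have h : ∀ θ : ℝ, (Real.cos θ - Complex.I * Real.sin θ : ℂ) ^ p *
      (Real.cos θ + Complex.I * Real.sin θ) ^ q =
        Complex.exp (((q - p : ℤ) : ℂ) * Complex.I * θ) := by
    intro θ
    have e1 : (Real.cos θ - Complex.I * Real.sin θ : ℂ) = Complex.exp (-(θ * Complex.I)) := by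
      rw [← neg_mul, Complex.exp_mul_I]; simp; ring
    have e2 : (Real.cos θ + Complex.I * Real.sin θ : ℂ) = Complex.exp (θ * Complex.I) := by
      rw [Complex.exp_mul_I]; simp; ring
    rw [e1, e2, ← Complex.exp_nat_mul, ← Complex.exp_nat_mul, ← Complex.exp_add]
    congr 1; push_cast; ring
  simp_rw [h]
  rw [← integral_Ioc_eq_integral_Ioo, ← intervalIntegral.integral_of_le (by linarith [Real.pi_pos])]
  split_ifs with hpq
  · subst hpq
    simp; ring
  · have hk : (((q - p : ℤ) : ℂ) * Complex.I) ≠ 0 := by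
      refine mul_ne_zero ?_ Complex.I_ne_zero
      exact_mod_cast (by omega : (q - p : ℤ) ≠ 0)
    rw [integral_exp_mul_complex hk, div_eq_zero_iff]
    left
    rw [sub_eq_zero, Complex.exp_eq_exp_iff_exists_int]
    refine ⟨q - p, ?_⟩
    push_cast; ring

/-- The integral over the slice of the ball at height `z`, where `c = 1 - z ^ 2`. -/
theorem integral_disc (p q : ℕ) {u c : ℝ} (hu : u < 1) (hc : 0 < c) :
    ∫ w : ℝ × ℝ, (if w.1 ^ 2 + w.2 ^ 2 ≤ c then (w.1 - Complex.I * w.2 : ℂ) ^ p *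
      (w.1 + Complex.I * w.2) ^ q * ((c - w.1 ^ 2 - w.2 ^ 2) ^ (-u) : ℝ) else 0) =
      if p = q then ((Real.pi * c ^ (p + 1 - u) *
        (p ! * Real.Gamma (1 - u) / Real.Gamma (p + 2 - u)) : ℝ) : ℂ) else 0 := by
  rw [← integral_comp_polarCoord_symm]
  have hs : ∀ w : ℝ × ℝ, (w.1 • (if (polarCoord.symm w).1 ^ 2 + (polarCoord.symm w).2 ^ 2 ≤ c then
      ((polarCoord.symm w).1 - Complex.I * (polarCoord.symm w).2 : ℂ) ^ p *
      ((polarCoord.symm w).1 + Complex.I * (polarCoord.symm w).2) ^ q *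
      ((c - (polarCoord.symm w).1 ^ 2 - (polarCoord.symm w).2 ^ 2) ^ (-u) : ℝ) else 0)) =
      ((w.1 * (if w.1 ^ 2 ≤ c then w.1 ^ (p + q) * (c - w.1 ^ 2) ^ (-u) else 0) : ℝ) : ℂ) *
      ((Real.cos w.2 - Complex.I * Real.sin w.2 : ℂ) ^ p *
        (Real.cos w.2 + Complex.I * Real.sin w.2) ^ q) := by
    intro w
    have e1 : (w.1 * Real.cos w.2) ^ 2 + (w.1 * Real.sin w.2) ^ 2 = w.1 ^ 2 := by
      rw [mul_pow, mul_pow, ← mul_add, Real.cos_sq_add_sin_sq, mul_one]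
    have e2 : c - (w.1 * Real.cos w.2) ^ 2 - (w.1 * Real.sin w.2) ^ 2 = c - w.1 ^ 2 := by
      linarith
    simp only [polarCoord_symm_apply, e1, e2]
    split_ifs
    · rw [Complex.real_smul]; push_cast
      rw [show (w.1 * Complex.cos w.2 - Complex.I * (w.1 * Complex.sin w.2) : ℂ) =
        w.1 * (Complex.cos w.2 - Complex.I * Complex.sin w.2) by ring,
        show (w.1 * Complex.cos w.2 + Complex.I * (w.1 * Complex.sin w.2) : ℂ) =
        w.1 * (Complex.cos w.2 + Complex.I * Complex.sin w.2) by ring, mul_pow, mul_pow]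
      ring
    · simp
  simp_rw [hs]
  rw [polarCoord_target, Measure.volume_eq_prod, setIntegral_prod_mul
    (fun r : ℝ => ((r * (if r ^ 2 ≤ c then r ^ (p + q) * (c - r ^ 2) ^ (-u) else 0) : ℝ) : ℂ))
    (fun θ : ℝ => (Real.cos θ - Complex.I * Real.sin θ : ℂ) ^ p *
        (Real.cos θ + Complex.I * Real.sin θ) ^ q), integral_angular]
  split_ifs with hpq
  · subst hpq
    rw [integral_complex_ofReal, ← two_mul p, integral_radial p hu hc, ← Complex.ofReal_mul]
    congr 1; ring
  · simp

/-! ### Integrals over the ball -/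

theorem integral_axial (a b m : ℕ) {u : ℝ} (hu : u < 1) :
    ∫ z in Set.Ioo (-1 : ℝ) 1, (1 + z) ^ a * (1 - z) ^ b * (1 - z ^ 2) ^ (m + 1 - u) =
      2 ^ (a + b + 2 * m + 3 - 2 * u) * (Real.Gamma (a + m + 2 - u) * Real.Gamma (b + m + 2 - u) /
        Real.Gamma (a + b + 2 * m + 4 - 2 * u)) := by
  have h := integral_Ioc_rpow_mul_sub_rpow (s := a + m + 2 - u) (t := b + m + 2 - u) (c := 2)
    (by linarith [a.cast_nonneg (α := ℝ), m.cast_nonneg (α := ℝ)])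
    (by linarith [b.cast_nonneg (α := ℝ), m.cast_nonneg (α := ℝ)]) two_pos
  rw [show (a : ℝ) + m + 2 - u + (b + m + 2 - u) - 1 = a + b + 2 * m + 3 - 2 * u by ring,
    show (a : ℝ) + m + 2 - u + (b + m + 2 - u) = a + b + 2 * m + 4 - 2 * u by ring] at h
  rw [← h, ← intervalIntegral.integral_of_le two_pos.le]
  have h2 := intervalIntegral.integral_comp_add_right (a := -1) (b := 1)
    (fun x : ℝ => x ^ (a + m + 2 - u - 1) * (2 - x) ^ (b + m + 2 - u - 1)) 1
  norm_num only at h2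
  rw [← h2, intervalIntegral.integral_of_le (by norm_num), integral_Ioc_eq_integral_Ioo]
  refine setIntegral_congr_fun measurableSet_Ioo fun z hz => ?_
  have h1 : 0 < z + 1 := by linarith [hz.1]
  have h3 : 0 < 1 - z := by linarith [hz.2]
  rw [show 2 - (z + 1) = 1 - z by ring, show 1 - z ^ 2 = (z + 1) * (1 - z) by ring,
    Real.mul_rpow h1.le h3.le, show (a : ℝ) + m + 2 - u - 1 = a + (m + 1 - u) by ring,
    show (b : ℝ) + m + 2 - u - 1 = b + (m + 1 - u) by ring, Real.rpow_add h1, Real.rpow_add h3,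
    Real.rpow_natCast, Real.rpow_natCast, add_comm 1 z]
  ring

/-- The integrand on the ball, extended by zero, with the coordinates grouped as `((x, y), z)`. -/
theorem measurable_ballIntegrand (a b p q : ℕ) (u : ℝ) :
    Measurable fun w : (ℝ × ℝ) × ℝ => if w.1.1 ^ 2 + w.1.2 ^ 2 ≤ 1 - w.2 ^ 2 then
      ((1 + w.2) ^ a * (1 - w.2) ^ b : ℂ) *
      ((w.1.1 - Complex.I * w.1.2 : ℂ) ^ p * (w.1.1 + Complex.I * w.1.2) ^ q *
        ((1 - w.2 ^ 2 - w.1.1 ^ 2 - w.1.2 ^ 2) ^ (-u) : ℝ)) else 0 := by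
  refine Measurable.ite (measurableSet_le (by fun_prop) (by fun_prop)) ?_ measurable_const
  fun_prop

theorem integral_disc_weight {u c : ℝ} (hu : u < 1) (hc : 0 < c) :
    ∫ w : ℝ × ℝ, (if w.1 ^ 2 + w.2 ^ 2 ≤ c then (c - w.1 ^ 2 - w.2 ^ 2) ^ (-u) else 0) =
      Real.pi * c ^ (1 - u) * (Real.Gamma (1 - u) / Real.Gamma (2 - u)) := by
  have h := integral_disc 0 0 hu hc
  rw [← Complex.ofReal_inj, ← integral_complex_ofReal]
  simpa [apply_ite] using h

/-- The weight `(1 - r²)^{-u}` on the ball, which is unbounded for `0 < u < 1`, is integrable. -/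
theorem integrable_weight {u : ℝ} (hu : u < 1) :
    Integrable fun w : (ℝ × ℝ) × ℝ => if w.1.1 ^ 2 + w.1.2 ^ 2 ≤ 1 - w.2 ^ 2 then
      (1 - w.2 ^ 2 - w.1.1 ^ 2 - w.1.2 ^ 2) ^ (-u) else (0 : ℝ) := by
  have hK : 0 < Real.Gamma (1 - u) / Real.Gamma (2 - u) :=
    div_pos (Real.Gamma_pos_of_pos (by linarith)) (Real.Gamma_pos_of_pos (by linarith))
  have hne : ∀ᵐ z : ℝ, z ≠ 1 ∧ z ≠ -1 := by
    refine (ae_iff.2 ?_).and (ae_iff.2 ?_) <;> simp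
  have hneg : ∀ z : ℝ, 1 - z ^ 2 < 0 → ∀ w : ℝ × ℝ, ¬ (w.1 ^ 2 + w.2 ^ 2 ≤ 1 - z ^ 2) := by
    intro z hz w; nlinarith [sq_nonneg w.1, sq_nonneg w.2]
  rw [Measure.volume_eq_prod, integrable_prod_iff']
  · constructor
    · filter_upwards [hne] with z hz
      rcases lt_trichotomy (1 - z ^ 2) 0 with h | h | h
      · simp [hneg z h]
      · exfalso
        have : (z - 1) * (z + 1) = 0 := by linarith
        rcases mul_eq_zero.1 this with h | h
        · exact hz.1 (by linarith)
        · exact hz.2 (by linarith)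
      -- the Bochner integral of a function that is not integrable would be zero
      · refine Integrable.of_integral_ne_zero ?_
        rw [integral_disc_weight hu h]
        have := Real.rpow_pos_of_pos h (1 - u)
        have := Real.pi_pos
        positivity
  -- the integral of the slice is a continuous function of the height `z ∈ (-1, 1)`
    · have : Integrable (Set.indicator (Set.Ioo (-1 : ℝ) 1) fun z =>
          Real.pi * (1 - z ^ 2) ^ (1 - u) * (Real.Gamma (1 - u) / Real.Gamma (2 - u))) := by
        rw [integrable_indicator_iff measurableSet_Ioo]
        refine IntegrableOn.mono_set ?_ Set.Ioo_subset_Icc_self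
        refine ContinuousOn.integrableOn_compact isCompact_Icc ?_
        refine Continuous.continuousOn ?_
        refine (continuous_const.mul (Continuous.rpow_const (by fun_prop) ?_)).mul continuous_const
        intro z; right; linarith
      refine this.congr ?_
      filter_upwards [hne] with z hz
      by_cases h : 1 - z ^ 2 < 0
      · simp only [hneg z h, if_false]
        rw [Set.indicator_of_notMem]
        · simp
        · rintro ⟨h1, h2⟩; nlinarith
      · have hz' : z ∈ Set.Ioo (-1 : ℝ) 1 := by
          have h3 := abs_le_of_sq_le_sq' (a := z) (b := 1) (by linarith) zero_le_one
          exact ⟨lt_of_le_of_ne h3.1 hz.2.symm, lt_of_le_of_ne h3.2 hz.1⟩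
        have h4 : 0 < 1 - z ^ 2 := by nlinarith [hz'.1, hz'.2]
        rw [Set.indicator_of_mem hz', ← integral_disc_weight hu h4]
        refine integral_congr_ae (Filter.Eventually.of_forall fun w => ?_)
        simp only
        rw [Real.norm_of_nonneg]
        split_ifs with h5
        · exact Real.rpow_nonneg (by linarith) _
        · exact le_rfl
  · refine (Measurable.ite (measurableSet_le (by fun_prop) (by fun_prop)) ?_
      measurable_const).aestronglyMeasurable
    fun_prop

theorem integrable_ballIntegrand (a b p q : ℕ) {u : ℝ} (hu : u < 1) :
    Integrable fun w : (ℝ × ℝ) × ℝ => if w.1.1 ^ 2 + w.1.2 ^ 2 ≤ 1 - w.2 ^ 2 then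
      ((1 + w.2) ^ a * (1 - w.2) ^ b : ℂ) *
      ((w.1.1 - Complex.I * w.1.2 : ℂ) ^ p * (w.1.1 + Complex.I * w.1.2) ^ q *
        ((1 - w.2 ^ 2 - w.1.1 ^ 2 - w.1.2 ^ 2) ^ (-u) : ℝ)) else 0 := by
  refine Integrable.mono' ((integrable_weight hu).const_mul (2 ^ a * 2 ^ b * (2 ^ p * 2 ^ q)))
    (measurable_ballIntegrand a b p q u).aestronglyMeasurable
    (Filter.Eventually.of_forall fun w => ?_)
  split_ifs with h
  · have h0 : 0 ≤ 1 - w.2 ^ 2 - w.1.1 ^ 2 - w.1.2 ^ 2 := by linarith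
    have hz : |w.2| ≤ 1 := abs_le_of_sq_le_sq (by nlinarith [sq_nonneg w.1.1, sq_nonneg w.1.2])
      zero_le_one
    have hx : |w.1.1| ≤ 1 := abs_le_of_sq_le_sq (by nlinarith [sq_nonneg w.2, sq_nonneg w.1.2])
      zero_le_one
    have hy : |w.1.2| ≤ 1 := abs_le_of_sq_le_sq (by nlinarith [sq_nonneg w.2, sq_nonneg w.1.1])
      zero_le_one
    have n1 : ‖(1 + w.2 : ℂ)‖ ≤ 2 := (norm_add_le _ _).trans (by simp; linarith)
    have n2 : ‖(1 - w.2 : ℂ)‖ ≤ 2 := (norm_sub_le _ _).trans (by simp; linarith)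
    have n3 : ‖(w.1.1 - Complex.I * w.1.2 : ℂ)‖ ≤ 2 := (norm_sub_le _ _).trans (by simp; linarith)
    have n4 : ‖(w.1.1 + Complex.I * w.1.2 : ℂ)‖ ≤ 2 := (norm_add_le _ _).trans (by simp; linarith)
    rw [norm_mul, norm_mul, norm_mul, norm_mul, norm_pow, norm_pow, norm_pow, norm_pow,
      Complex.norm_real, Real.norm_of_nonneg (Real.rpow_nonneg h0 _), ← mul_assoc]
    have := Real.rpow_nonneg h0 (-u)
    gcongr
  · simp

theorem measurableSet_unitBall : MeasurableSet unitBall :=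
  measurableSet_le (by fun_prop) (by fun_prop)

theorem mem_unitBall_iff (x y z : ℝ) :
    (x, y, z) ∈ unitBall ↔ x ^ 2 + y ^ 2 ≤ 1 - z ^ 2 := by
  change x ^ 2 + y ^ 2 + z ^ 2 ≤ 1 ↔ _
  constructor <;> intro h <;> linarith

/-- The monomials in `1 ± z` and `x ± iy`, integrated over the ball against the weight
`(1 - r²)^{-u}`. -/
theorem integral_ball (a b p q : ℕ) {u : ℝ} (hu : u < 1) :
    ∫ w in unitBall, (1 + w.2.2 : ℂ) ^ a * (1 - w.2.2) ^ b * (w.1 - Complex.I * w.2.1) ^ p *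
      (w.1 + Complex.I * w.2.1) ^ q * ((1 - w.1 ^ 2 - w.2.1 ^ 2 - w.2.2 ^ 2) ^ (-u) : ℝ) =
      if p = q then ((Real.pi * (p ! * Real.Gamma (1 - u) / Real.Gamma (p + 2 - u)) *
        (2 ^ (a + b + 2 * p + 3 - 2 * u) * (Real.Gamma (a + p + 2 - u) *
          Real.Gamma (b + p + 2 - u) / Real.Gamma (a + b + 2 * p + 4 - 2 * u))) : ℝ) : ℂ)
      else 0 := by
  rw [← integral_indicator measurableSet_unitBall,
    ← (volume_preserving_prodAssoc (α₁ := ℝ) (β₁ := ℝ) (γ₁ := ℝ)).integral_comp']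
  have e : ∀ w : (ℝ × ℝ) × ℝ, Set.indicator unitBall (fun w : ℝ × ℝ × ℝ => (1 + w.2.2 : ℂ) ^ a *
      (1 - w.2.2) ^ b * (w.1 - Complex.I * w.2.1) ^ p * (w.1 + Complex.I * w.2.1) ^ q *
      ((1 - w.1 ^ 2 - w.2.1 ^ 2 - w.2.2 ^ 2) ^ (-u) : ℝ)) (MeasurableEquiv.prodAssoc w) =
      if w.1.1 ^ 2 + w.1.2 ^ 2 ≤ 1 - w.2 ^ 2 then ((1 + w.2) ^ a * (1 - w.2) ^ b : ℂ) *
      ((w.1.1 - Complex.I * w.1.2 : ℂ) ^ p * (w.1.1 + Complex.I * w.1.2) ^ q *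
        ((1 - w.2 ^ 2 - w.1.1 ^ 2 - w.1.2 ^ 2) ^ (-u) : ℝ)) else 0 := by
    rintro ⟨⟨x, y⟩, z⟩
    have h1 : MeasurableEquiv.prodAssoc ((x, y), z) = (x, y, z) := rfl
    rw [h1]
    have h2 := mem_unitBall_iff x y z
    by_cases h : x ^ 2 + y ^ 2 ≤ 1 - z ^ 2
    · rw [Set.indicator_of_mem (h2.2 h), if_pos h]
      simp only
      rw [show 1 - x ^ 2 - y ^ 2 - z ^ 2 = 1 - z ^ 2 - x ^ 2 - y ^ 2 by ring]
      ring
    · rw [Set.indicator_of_notMem (mt h2.1 h), if_neg h]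
  simp_rw [e]
  rw [Measure.volume_eq_prod, integral_prod_symm _ (integrable_ballIntegrand a b p q hu)]
  -- the slices at the poles `z = ±1` are points and are left out
  have hslice : ∀ z : ℝ, z ≠ -1 → z ≠ 1 → ∫ w : ℝ × ℝ, (if w.1 ^ 2 + w.2 ^ 2 ≤ 1 - z ^ 2 then
      ((1 + z) ^ a * (1 - z) ^ b : ℂ) *
      ((w.1 - Complex.I * w.2 : ℂ) ^ p * (w.1 + Complex.I * w.2) ^ q *
        ((1 - z ^ 2 - w.1 ^ 2 - w.2 ^ 2) ^ (-u) : ℝ)) else 0) =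
      Set.indicator (Set.Ioo (-1 : ℝ) 1) (fun z => if p = q then
        ((Real.pi * (p ! * Real.Gamma (1 - u) / Real.Gamma (p + 2 - u)) *
        ((1 + z) ^ a * (1 - z) ^ b * (1 - z ^ 2) ^ (p + 1 - u)) : ℝ) : ℂ) else 0) z := by
    intro z hz1 hz2
    by_cases hz : z ∈ Set.Ioo (-1 : ℝ) 1
    · have h4 : 0 < 1 - z ^ 2 := by nlinarith [hz.1, hz.2]
      rw [Set.indicator_of_mem hz]
      have := integral_disc p q hu h4
      simp_rw [← mul_ite_zero] at this ⊢
      rw [integral_const_mul, this]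
      split_ifs
      · push_cast; ring
      · simp
    · rw [Set.indicator_of_notMem hz]
      have : ∀ w : ℝ × ℝ, ¬ (w.1 ^ 2 + w.2 ^ 2 ≤ 1 - z ^ 2) := by
        intro w hw
        have h3 := abs_le_of_sq_le_sq' (a := z) (b := 1)
          (by nlinarith [sq_nonneg w.1, sq_nonneg w.2]) zero_le_one
        exact hz ⟨lt_of_le_of_ne h3.1 hz1.symm, lt_of_le_of_ne h3.2 hz2⟩
      simp [this]
  have hae : ∀ᵐ z : ℝ, z ≠ -1 ∧ z ≠ 1 := by
    refine (ae_iff.2 ?_).and (ae_iff.2 ?_) <;> simp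
  rw [integral_congr_ae (hae.mono fun z hz => hslice z hz.1 hz.2),
    integral_indicator measurableSet_Ioo]
  split_ifs
  · rw [integral_complex_ofReal, integral_const_mul, integral_axial a b p hu]
  · simp

/-- Legendre's duplication formula, in the form that turns the Beta function of the height integral
into the denominators of the entries. -/
theorem two_rpow_div_Gamma (a b p : ℕ) {u : ℝ} (hu : u < 1) :
    2 ^ (a + b + 2 * p + 3 - 2 * u) / Real.Gamma (a + b + 2 * p + 4 - 2 * u) =
      √Real.pi / (Real.Gamma (2 + ((a + b + 2 * p : ℕ) : ℝ) / 2 - u) *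
        Real.Gamma (5 / 2 + ((a + b + 2 * p : ℕ) : ℝ) / 2 - u)) := by
  set N : ℕ := a + b + 2 * p with hN
  have hN' : (a : ℝ) + b + 2 * p = N := by rw [hN]; push_cast; ring
  rw [hN']
  have h0 : (0 : ℝ) ≤ N := N.cast_nonneg
  have h := Real.Gamma_mul_Gamma_add_half (2 + (N : ℝ) / 2 - u)
  rw [show 2 + (N : ℝ) / 2 - u + 1 / 2 = 5 / 2 + N / 2 - u by ring,
    show 2 * (2 + (N : ℝ) / 2 - u) = N + 4 - 2 * u by ring] at h
  rw [h, show 1 - ((N : ℝ) + 4 - 2 * u) = -(N + 3 - 2 * u) by ring, Real.rpow_neg two_pos.le]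
  have g1 := (Real.Gamma_pos_of_pos (show 0 < (N : ℝ) + 4 - 2 * u by linarith)).ne'
  have g2 := (Real.rpow_pos_of_pos two_pos ((N : ℝ) + 3 - 2 * u)).ne'
  have g3 := (Real.sqrt_pos.2 Real.pi_pos).ne'
  field_simp

/-! ### Averages of products of entries of `ρ` -/

/-- A form of Vandermonde's convolution. If `S k l c` denotes the left side, Pascal's rule gives the
recursion `S (k + 1) (l + 1) c = S k (l + 1) c + (l + 1) * S k l (c + 1)`. -/
theorem sum_choose_mul_choose_div_Gamma (k : ℕ) : ∀ (l : ℕ) {c : ℝ}, 0 < c →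
    ∑ j ∈ Finset.range (k + 1), (k.choose j * l.choose j : ℝ) * (j ! / Real.Gamma (j + c)) =
      Real.Gamma (k + l + c) / (Real.Gamma (k + c) * Real.Gamma (l + c)) := by
  induction k with
  | zero =>
    intro l c hc
    have g1 := (Real.Gamma_pos_of_pos hc).ne'
    have g2 := (Real.Gamma_pos_of_pos (show 0 < l + c by positivity)).ne'
    simp; field_simp
  | succ k ih =>
    intro l c hc
    have hsplit : ∑ j ∈ Finset.range (k + 1 + 1),
        ((k + 1).choose j * l.choose j : ℝ) * (j ! / Real.Gamma (j + c)) =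
        ∑ j ∈ Finset.range (k + 1), (k.choose j * l.choose j : ℝ) * (j ! / Real.Gamma (j + c)) +
        ∑ j ∈ Finset.range (k + 1), (k.choose j * l.choose (j + 1) : ℝ) *
          ((j + 1)! / Real.Gamma ((j + 1 : ℕ) + c)) := by
      have h0 : ∑ j ∈ Finset.range (k + 1),
          (k.choose j * l.choose j : ℝ) * (j ! / Real.Gamma (j + c)) =
          ∑ j ∈ Finset.range (k + 1 + 1),
          (k.choose j * l.choose j : ℝ) * (j ! / Real.Gamma (j + c)) := by
        rw [Finset.sum_range_succ _ (k + 1)]; simp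
      rw [h0, Finset.sum_range_succ', Finset.sum_range_succ' _ (k + 1), add_right_comm,
        ← Finset.sum_add_distrib]
      simp only [Nat.choose_zero_right]
      congr 1
      refine Finset.sum_congr rfl fun j _ => ?_
      rw [Nat.choose_succ_succ]; push_cast; ring
    rw [hsplit, ih l hc]
    have g1 := (Real.Gamma_pos_of_pos (show 0 < k + c by positivity)).ne'
    have g2 := (Real.Gamma_pos_of_pos (show 0 < l + c by positivity)).ne'
    have e1 : Real.Gamma (((k + 1 : ℕ) : ℝ) + c) = (k + c) * Real.Gamma (k + c) := by
      rw [← Real.Gamma_add_one (by positivity)]; congr 1; push_cast; ring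
    have e2 : Real.Gamma (((k + 1 : ℕ) : ℝ) + l + c) = (k + l + c) * Real.Gamma (k + l + c) := by
      rw [← Real.Gamma_add_one (by positivity)]; congr 1; push_cast; ring
    rw [e1, e2]
    have hkc : (k : ℝ) + c ≠ 0 := by positivity
    cases l with
    | zero => simp; field_simp
    | succ l =>
      have h1 : ∑ j ∈ Finset.range (k + 1), (k.choose j * (l + 1).choose (j + 1) : ℝ) *
          ((j + 1)! / Real.Gamma ((j + 1 : ℕ) + c)) =
          (l + 1) * ∑ j ∈ Finset.range (k + 1), (k.choose j * l.choose j : ℝ) *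
          (j ! / Real.Gamma (j + (c + 1))) := by
        rw [Finset.mul_sum]
        refine Finset.sum_congr rfl fun j _ => ?_
        have h2 : ((l + 1 : ℕ) : ℝ) * l.choose j = (l + 1).choose (j + 1) * (j + 1 : ℕ) := by
          exact_mod_cast Nat.add_one_mul_choose_eq l j
        rw [Nat.factorial_succ, show ((j + 1 : ℕ) : ℝ) + c = j + (c + 1) by push_cast; ring]
        push_cast at h2 ⊢
        linear_combination (-(k.choose j : ℝ) * (j ! / Real.Gamma (j + (c + 1)))) * h2
      rw [h1, ih l (by positivity : 0 < c + 1),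
        show (k : ℝ) + l + (c + 1) = k + (l + 1 : ℕ) + c by push_cast; ring,
        show (k : ℝ) + (c + 1) = k + c + 1 by ring, Real.Gamma_add_one hkc,
        show (l : ℝ) + (c + 1) = (l + 1 : ℕ) + c by push_cast; ring]
      field_simp
      push_cast; ring

/-- A set `Y ⊆ C` with `|Y| = |E|` arises from `E` by removing `j` elements and adding `j`
elements of `C \ E`, for a unique `j`. -/
theorem sum_powersetCard_sdiff {α M : Type*} [DecidableEq α] [AddCommMonoid M] {C E : Finset α}
    (hE : E ⊆ C) (f : ℕ → M) :
    ∑ Y ∈ C.powersetCard E.card, f (E \ Y).card =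
      ∑ j ∈ Finset.range (E.card + 1), (E.card.choose j * (C \ E).card.choose j) • f j := by
  have h : ∀ j, (E.card.choose j * (C \ E).card.choose j) • f j =
      ∑ x ∈ E.powersetCard j ×ˢ (C \ E).powersetCard j, f j := by
    intro j
    rw [Finset.sum_const, Finset.card_product, Finset.card_powersetCard, Finset.card_powersetCard]
  simp_rw [h]
  rw [Finset.sum_sigma']
  refine Finset.sum_bij' (fun Y _ => (⟨(E \ Y).card, (E \ Y, Y \ E)⟩ : Σ _ : ℕ, _ × _))
    (fun x _ => (E \ x.2.1) ∪ x.2.2) ?_ ?_ ?_ ?_ ?_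
  · intro Y hY
    rw [Finset.mem_powersetCard] at hY
    simp only [Finset.mem_sigma, Finset.mem_range, Finset.mem_product, Finset.mem_powersetCard]
    refine ⟨Nat.lt_succ_of_le (Finset.card_le_card Finset.sdiff_subset),
      ⟨Finset.sdiff_subset, trivial⟩, Finset.sdiff_subset_sdiff hY.1 subset_rfl, ?_⟩
    exact Finset.card_sdiff_comm hY.2
  · rintro ⟨j, U, V⟩ hx
    simp only [Finset.mem_sigma, Finset.mem_range, Finset.mem_product,
      Finset.mem_powersetCard] at hx ⊢
    obtain ⟨hj, ⟨hU, hUj⟩, hV, hVj⟩ := hx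
    refine ⟨Finset.union_subset (Finset.sdiff_subset.trans hE)
      (hV.trans Finset.sdiff_subset), ?_⟩
    rw [Finset.card_union_of_disjoint, Finset.card_sdiff_of_subset hU, hUj, hVj]
    · omega
    · exact Finset.disjoint_of_subset_left Finset.sdiff_subset
        (Finset.disjoint_of_subset_right hV Finset.disjoint_sdiff)
  · intro Y hY
    simp only
    ext x; simp; tauto
  · rintro ⟨j, U, V⟩ hx
    simp only [Finset.mem_sigma, Finset.mem_range, Finset.mem_product,
      Finset.mem_powersetCard] at hx
    obtain ⟨hj, ⟨hU, rfl⟩, hV, hVj⟩ := hx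
    have e1 : E \ (E \ U ∪ V) = U := by
      ext x
      have := @hU x; have := @hV x
      simp at *; tauto
    have e2 : (E \ U ∪ V) \ E = V := by
      ext x
      have := @hU x; have := @hV x
      simp at *; tauto
    simp only [e1, e2]
  · intro Y hY; rfl

theorem prod_rho {α : Type*} [DecidableEq α] (C I J : Finset α) (x y z : ℝ) :
    ∏ k ∈ C, rho x y z (decide (k ∈ I)) (decide (k ∈ J)) =
      ((1 + z) / 2 : ℂ) ^ (C.filter fun k => k ∈ I ∧ k ∈ J).card *
      ((1 - z) / 2 : ℂ) ^ (C.filter fun k => k ∉ I ∧ k ∉ J).card *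
      ((x - Complex.I * y) / 2 : ℂ) ^ (C.filter fun k => k ∈ I ∧ k ∉ J).card *
      ((x + Complex.I * y) / 2 : ℂ) ^ (C.filter fun k => k ∉ I ∧ k ∈ J).card := by
  have h : ∀ (t : ℂ) (p : α → Prop) [DecidablePred p],
      t ^ (C.filter p).card = ∏ k ∈ C, if p k then t else 1 := by
    intro t p _
    rw [Finset.prod_ite, Finset.prod_const, Finset.prod_const_one, mul_one]
  rw [h, h, h, h, ← Finset.prod_mul_distrib, ← Finset.prod_mul_distrib, ← Finset.prod_mul_distrib]
  refine Finset.prod_congr rfl fun k _ => ?_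
  by_cases h1 : k ∈ I <;> by_cases h2 : k ∈ J <;> simp [h1, h2, rho]

/-- The integral over the ball, against `(1 - r²)^{-u}`, of a product of `N` entries of `ρ`: `k`
from the first row, `l` from the second one, with `p` entries `(x - iy) / 2` and `p` entries
`(x + iy) / 2` among them. -/
noncomputable def moment (u : ℝ) (N p k l : ℕ) : ℝ :=
  Real.pi * √Real.pi * Real.Gamma (1 - u) * (p ! / Real.Gamma (p + 2 - u)) *
    (Real.Gamma (k + 2 - u) * Real.Gamma (l + 2 - u)) /
    (2 ^ N * (Real.Gamma (2 + N / 2 - u) * Real.Gamma (5 / 2 + N / 2 - u)))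

theorem integral_prod_rho {α : Type*} [DecidableEq α] (C I J : Finset α) {u : ℝ} (hu : u < 1) :
    ∫ w in unitBall, (∏ k ∈ C, rho w.1 w.2.1 w.2.2 (decide (k ∈ I)) (decide (k ∈ J))) *
      ((1 - w.1 ^ 2 - w.2.1 ^ 2 - w.2.2 ^ 2) ^ (-u) : ℝ) =
      if (C.filter fun k => k ∈ I ∧ k ∉ J).card = (C.filter fun k => k ∉ I ∧ k ∈ J).card then
        ((moment u C.card (C.filter fun k => k ∈ I ∧ k ∉ J).card
          (C.filter fun k => k ∈ I).card (C.filter fun k => k ∉ I).card : ℝ) : ℂ) else 0 := by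
  simp_rw [prod_rho]
  have hp : (C.filter fun k => k ∈ I).card = (C.filter fun k => k ∈ I ∧ k ∈ J).card +
      (C.filter fun k => k ∈ I ∧ k ∉ J).card := by
    rw [← Finset.card_filter_add_card_filter_not (s := C.filter fun k => k ∈ I) (fun k => k ∈ J),
      Finset.filter_filter, Finset.filter_filter]
  have hq : (C.filter fun k => k ∉ I).card = (C.filter fun k => k ∉ I ∧ k ∉ J).card +
      (C.filter fun k => k ∉ I ∧ k ∈ J).card := by
    rw [add_comm, ← Finset.card_filter_add_card_filter_not (s := C.filter fun k => k ∉ I)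
      (fun k => k ∈ J), Finset.filter_filter, Finset.filter_filter]
  have hN := Finset.card_filter_add_card_filter_not (s := C) (fun k => k ∈ I)
  rw [← hN, hp, hq]
  generalize (C.filter fun k => k ∈ I ∧ k ∈ J).card = a
  generalize (C.filter fun k => k ∈ I ∧ k ∉ J).card = p
  generalize (C.filter fun k => k ∉ I ∧ k ∉ J).card = b
  generalize (C.filter fun k => k ∉ I ∧ k ∈ J).card = q
  have hb := integral_ball a b p q hu
  have e : ∀ w : ℝ × ℝ × ℝ, ((1 + w.2.2) / 2 : ℂ) ^ a * ((1 - w.2.2) / 2) ^ b *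
      ((w.1 - Complex.I * w.2.1) / 2) ^ p * ((w.1 + Complex.I * w.2.1) / 2) ^ q *
      ((1 - w.1 ^ 2 - w.2.1 ^ 2 - w.2.2 ^ 2) ^ (-u) : ℝ) =
      (2 ^ (a + b + p + q))⁻¹ * ((1 + w.2.2 : ℂ) ^ a * (1 - w.2.2) ^ b *
      (w.1 - Complex.I * w.2.1) ^ p * (w.1 + Complex.I * w.2.1) ^ q *
      ((1 - w.1 ^ 2 - w.2.1 ^ 2 - w.2.2 ^ 2) ^ (-u) : ℝ)) := by
    intro w
    simp only [div_pow, pow_add]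
    field_simp
  simp_rw [e]
  rw [integral_const_mul, hb]
  split_ifs with hpq
  · subst hpq
    have hc := two_rpow_div_Gamma a b p hu
    rw [moment, show a + p + (b + p) = a + b + 2 * p by ring]
    have e1 : 2 ^ ((a : ℝ) + b + 2 * p + 3 - 2 * u) * (Real.Gamma (a + p + 2 - u) *
          Real.Gamma (b + p + 2 - u) / Real.Gamma (a + b + 2 * p + 4 - 2 * u)) =
        Real.Gamma (a + p + 2 - u) * Real.Gamma (b + p + 2 - u) *
        (2 ^ ((a : ℝ) + b + 2 * p + 3 - 2 * u) / Real.Gamma (a + b + 2 * p + 4 - 2 * u)) := by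
      ring
    rw [e1, hc]
    rw [show (2 : ℂ) ^ (a + b + p + p) = ((2 ^ (a + b + 2 * p) : ℝ) : ℂ) by
      push_cast; ring, ← Complex.ofReal_inv, ← Complex.ofReal_mul]
    congr 1
    simp only [Nat.cast_add]
    field_simp
  · simp

/-- The vector of all basis vectors of weight `k` is an eigenvector of the averaged tensor power
over the index set `C`, with an eigenvalue that does not depend on `k`. The sum is over a row `I`
of this average, before normalization. -/
theorem sum_integral_prod_rho {α : Type*} [DecidableEq α] (C I : Finset α) (k : ℕ) {u : ℝ}
    (hu : u < 1) :
    ∑ Y ∈ C.powersetCard k,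
      ∫ w in unitBall, (∏ c ∈ C, rho w.1 w.2.1 w.2.2 (decide (c ∈ I)) (decide (c ∈ Y))) *
        ((1 - w.1 ^ 2 - w.2.1 ^ 2 - w.2.2 ^ 2) ^ (-u) : ℝ) =
      if (C.filter fun c => c ∈ I).card = k then
        ((Real.pi * √Real.pi * Real.Gamma (1 - u) * Real.Gamma (C.card + 2 - u) /
        (2 ^ C.card * (Real.Gamma (2 + C.card / 2 - u) *
          Real.Gamma (5 / 2 + C.card / 2 - u))) : ℝ) : ℂ) else 0 := by
  simp_rw [integral_prod_rho C I _ hu]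
  set E := C.filter fun c => c ∈ I with hE
  have hEC : E ⊆ C := Finset.filter_subset _ _
  have hp : ∀ Y, (C.filter fun k => k ∈ I ∧ k ∉ Y) = E \ Y := by
    intro Y; ext x; simp [hE]; tauto
  have hq : ∀ Y ∈ C.powersetCard k, (C.filter fun k => k ∉ I ∧ k ∈ Y) = Y \ E := by
    intro Y hY; ext x
    have := @(Finset.mem_powersetCard.1 hY).1 x
    simp [hE]; tauto
  have hiff : ∀ Y ∈ C.powersetCard k, ((C.filter fun k => k ∈ I ∧ k ∉ Y).card =
      (C.filter fun k => k ∉ I ∧ k ∈ Y).card ↔ E.card = k) := by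
    intro Y hY
    rw [hp, hq Y hY, ← (Finset.mem_powersetCard.1 hY).2]
    exact Finset.card_sdiff_eq_card_sdiff_iff
  rw [Finset.sum_congr rfl fun Y hY => if_congr (hiff Y hY) rfl rfl]
  split_ifs with hk
  · subst hk
    have hc : (C.filter fun k => k ∉ I) = C \ E := by
      ext x; simp [hE]; tauto
    simp_rw [hp, hc]
    rw [← Complex.ofReal_sum, sum_powersetCard_sdiff hEC
      (fun j => moment u C.card j E.card (C \ E).card)]
    congr 1
    have h := sum_choose_mul_choose_div_Gamma E.card (C \ E).card (show 0 < 2 - u by linarith)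
    have hN : (E.card : ℝ) + (C \ E).card = C.card := by
      have := Finset.card_sdiff_add_card_eq_card hEC
      rw [add_comm]; exact_mod_cast this
    rw [hN] at h
    have g1 := Real.Gamma_pos_of_pos (show 0 < (E.card : ℝ) + (2 - u) by
      linarith [E.card.cast_nonneg (α := ℝ)])
    have g2 := Real.Gamma_pos_of_pos (show 0 < ((C \ E).card : ℝ) + (2 - u) by
      linarith [(C \ E).card.cast_nonneg (α := ℝ)])
    rw [eq_div_iff (by positivity)] at h
    simp only [nsmul_eq_mul, moment, Nat.cast_mul]
    simp only [add_sub_assoc] at h ⊢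
    rw [← h, Finset.sum_mul, Finset.mul_sum, Finset.sum_div]
    refine Finset.sum_congr rfl fun j _ => ?_
    ring
  · simp

/-! ### The matrix `ζ` and the vectors of a pairing -/

/-- The normalizing constant of the density `q(u)`. -/
noncomputable def priorConst (u : ℝ) : ℝ :=
  Real.Gamma (5 / 2 - u) / (Real.pi * √Real.pi * Real.Gamma (1 - u))

theorem prior_eq (u : ℝ) {x y z : ℝ} (h : (x, y, z) ∈ unitBall) :
    prior u x y z = priorConst u * (1 - x ^ 2 - y ^ 2 - z ^ 2) ^ (-u) := by
  have h' : x ^ 2 + y ^ 2 + z ^ 2 ≤ 1 := h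
  rw [prior, priorConst, Real.rpow_neg (by linarith), show (3 / 2 : ℝ) = 1 + 1 / 2 by norm_num,
    Real.rpow_add Real.pi_pos, Real.rpow_one, ← Real.sqrt_eq_rpow]
  rw [← div_div, div_eq_mul_inv (_ / _) ((1 - x ^ 2 - y ^ 2 - z ^ 2) ^ u)]

theorem zeta_eq (n : ℕ) (u : ℝ) (I J : Finset (Fin n)) :
    zeta n u I J = priorConst u * ∫ w in unitBall,
      (∏ k, rho w.1 w.2.1 w.2.2 (decide (k ∈ I)) (decide (k ∈ J))) *
      ((1 - w.1 ^ 2 - w.2.1 ^ 2 - w.2.2 ^ 2) ^ (-u) : ℝ) := by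
  rw [zeta, ← integral_const_mul]
  refine setIntegral_congr_fun measurableSet_unitBall fun w hw => ?_
  rw [prior_eq u hw, rhoPow]
  push_cast; ring

theorem zeta_eq_entry (n : ℕ) {u : ℝ} (hu : u < 1) (I J : Finset (Fin n)) :
    zeta n u I J = ((entry n u I J : ℝ) : ℂ) := by
  have ha : (Finset.univ.filter fun k => k ∈ I ∧ k ∈ J) = I ∩ J := by ext; simp
  have hp : (Finset.univ.filter fun k => k ∈ I ∧ k ∉ J) = I \ J := by ext; simp
  have hq : (Finset.univ.filter fun k => k ∉ I ∧ k ∈ J) = J \ I := by ext; simp; tauto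
  have hI : (Finset.univ.filter fun k => k ∈ I) = I := by ext; simp
  have hI' : (Finset.univ.filter fun k => k ∉ I) = Iᶜ := by ext; simp
  rw [zeta_eq, integral_prod_rho _ _ _ hu, hp, hq, hI, hI', entry]
  simp only [@eq_comm _ (J \ I).card]
  split_ifs with h
  · have h1 : (I ∩ J).card + (I \ J).card = I.card := Finset.card_inter_add_card_sdiff I J
    have h2 : ((I ∪ J)ᶜ).card + (J \ I).card = Iᶜ.card := by
      rw [← Finset.card_union_of_disjoint]
      · congr 1; ext; simp; tauto
      · rw [Finset.disjoint_left]; intro x; simp; tauto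
    have h3 : I.card + Iᶜ.card = n := by
      rw [Finset.card_add_card_compl, Fintype.card_fin]
    rw [← h] at h2
    rw [← h1, ← h2] at h3 ⊢
    rw [Finset.card_univ, Fintype.card_fin]
    generalize (I ∩ J).card = a at *
    generalize ((I ∪ J)ᶜ).card = b at *
    generalize (I \ J).card = p at *
    have e : (n - a - b) / 2 = p := by omega
    have h4 : (n : ℝ) = a + b + 2 * p := by
      rw [← h3]; push_cast; ring
    rw [e, moment, priorConst, one_mul, ← Complex.ofReal_mul]
    congr 1
    push_cast
    rw [show 2 + (n : ℝ) / 2 + a / 2 - b / 2 - u = a + p + 2 - u by rw [h4]; ring,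
      show 2 + (n : ℝ) / 2 + b / 2 - a / 2 - u = b + p + 2 - u by rw [h4]; ring,
      show 2 + (n : ℝ) / 2 - a / 2 - b / 2 - u = p + 2 - u by rw [h4]; ring]
    have g := (Real.Gamma_pos_of_pos (show 0 < 1 - u by linarith)).ne'
    have g2 := (Real.sqrt_pos.2 Real.pi_pos).ne'
    field_simp
  · simp

theorem norm_rho_le {w : ℝ × ℝ × ℝ} (hw : w ∈ unitBall) (i j : Bool) :
    ‖rho w.1 w.2.1 w.2.2 i j‖ ≤ 1 := by
  obtain ⟨x, y, z⟩ := w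
  have h : x ^ 2 + y ^ 2 + z ^ 2 ≤ 1 := hw
  have hz : |z| ≤ 1 := abs_le_of_sq_le_sq (by nlinarith [sq_nonneg x, sq_nonneg y]) zero_le_one
  have hx : |x| ≤ 1 := abs_le_of_sq_le_sq (by nlinarith [sq_nonneg z, sq_nonneg y]) zero_le_one
  have hy : |y| ≤ 1 := abs_le_of_sq_le_sq (by nlinarith [sq_nonneg z, sq_nonneg x]) zero_le_one
  cases i <;> cases j <;> simp only [rho] <;> rw [norm_div, Complex.norm_two, div_le_one two_pos]
  · exact (norm_sub_le _ _).trans (by simp; linarith)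
  · exact (norm_add_le _ _).trans (by simp; linarith)
  · exact (norm_sub_le _ _).trans (by simp; linarith)
  · exact (norm_add_le _ _).trans (by simp; linarith)

theorem integrableOn_weight {u : ℝ} (hu : u < 1) :
    IntegrableOn (fun w : ℝ × ℝ × ℝ => (1 - w.1 ^ 2 - w.2.1 ^ 2 - w.2.2 ^ 2) ^ (-u)) unitBall := by
  rw [← integrable_indicator_iff measurableSet_unitBall,
    ← (volume_preserving_prodAssoc (α₁ := ℝ) (β₁ := ℝ) (γ₁ := ℝ)).integrable_comp_emb
      MeasurableEquiv.prodAssoc.measurableEmbedding]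
  refine (integrable_weight hu).congr (Filter.Eventually.of_forall ?_)
  rintro ⟨⟨x, y⟩, z⟩
  have h1 : MeasurableEquiv.prodAssoc ((x, y), z) = (x, y, z) := rfl
  have h2 := mem_unitBall_iff x y z
  rw [Function.comp_apply, h1]
  simp only
  by_cases h : x ^ 2 + y ^ 2 ≤ 1 - z ^ 2
  · rw [Set.indicator_of_mem (h2.2 h), if_pos h]
    rw [show 1 - x ^ 2 - y ^ 2 - z ^ 2 = 1 - z ^ 2 - x ^ 2 - y ^ 2 by ring]
  · rw [Set.indicator_of_notMem (mt h2.1 h), if_neg h]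

theorem integrableOn_prod_rho {α : Type*} [DecidableEq α] (C I J : Finset α) {u : ℝ} (hu : u < 1) :
    IntegrableOn (fun w : ℝ × ℝ × ℝ =>
      (∏ k ∈ C, rho w.1 w.2.1 w.2.2 (decide (k ∈ I)) (decide (k ∈ J))) *
      (((1 - w.1 ^ 2 - w.2.1 ^ 2 - w.2.2 ^ 2) ^ (-u) : ℝ) : ℂ)) unitBall := by
  refine Integrable.bdd_mul (c := 1) (integrableOn_weight hu).ofReal ?_ ?_
  · refine Measurable.aestronglyMeasurable (Finset.measurable_prod _ fun k _ => ?_)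
    cases decide (k ∈ I) <;> cases decide (k ∈ J) <;> simp only [rho] <;> fun_prop
  · filter_upwards [ae_restrict_mem measurableSet_unitBall] with w hw
    rw [norm_prod]
    exact Finset.prod_le_one (fun _ _ => norm_nonneg _) fun k _ => norm_rho_le hw _ _

/-- A pair of rows of `ρ ⊗ ρ`, applied to the singlet, gives `det ρ` times the coordinate of the
singlet. -/
theorem rho_minor (x y z : ℝ) (i j : Bool) :
    rho x y z i false * rho x y z j true - rho x y z i true * rho x y z j false =
      (((1 - x ^ 2 - y ^ 2 - z ^ 2) / 4 : ℝ) : ℂ) *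
        ((if i = false ∧ j = true then 1 else 0) - (if i = true ∧ j = false then 1 else 0)) := by
  cases i <;> cases j <;> simp [rho] <;> ring_nf <;> simp [Complex.I_sq] <;> ring

section Pairing

variable {n d : ℕ} (α β : Fin d ↪ Fin n)

/-- The labels outside the pairs `{α i, β i}`. -/
def unpaired : Finset (Fin n) := (Finset.univ.map α ∪ Finset.univ.map β)ᶜ

/-- The set that contains `α i` if `i ∈ x` and `β i` if `i ∉ x`, and in addition the elements of
`Y`. -/
def pairedSet (x : Finset (Fin d)) (Y : Finset (Fin n)) : Finset (Fin n) :=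
  x.map α ∪ xᶜ.map β ∪ Y

/-- The tensor product of the singlets on the pairs `{α i, β i}` with the sum of all basis vectors
of weight `k` on the unpaired labels. The pairs are indexed by `Fin d` and given by two
embeddings, which are to have disjoint ranges. -/
noncomputable def pairVec (k : ℕ) : Finset (Fin n) → ℂ :=
  ∑ x : Finset (Fin d), ∑ Y ∈ (unpaired α β).powersetCard k,
    (-1 : ℂ) ^ x.card • Pi.single (pairedSet α β x Y) 1

variable {α β}

theorem sum_mul_pairVec (g : Finset (Fin n) → ℂ) (k : ℕ) :
    ∑ Z, g Z * pairVec α β k Z =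
      ∑ x : Finset (Fin d), ∑ Y ∈ (unpaired α β).powersetCard k,
        (-1 : ℂ) ^ x.card * g (pairedSet α β x Y) := by
  simp only [pairVec, Finset.sum_apply, Pi.smul_apply, Finset.mul_sum, smul_eq_mul]
  rw [Finset.sum_comm]
  refine Finset.sum_congr rfl fun x _ => ?_
  rw [Finset.sum_comm]
  refine Finset.sum_congr rfl fun Y _ => ?_
  rw [Finset.sum_eq_single (pairedSet α β x Y)]
  · simp [mul_comm]
  · intro Z _ hZ; simp [hZ]
  · simp

variable (hd : ∀ i j, α i ≠ β j)
include hd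

theorem disjoint_map_map (x y : Finset (Fin d)) : Disjoint (x.map α) (y.map β) := by
  rw [Finset.disjoint_left]; intro a; simp only [Finset.mem_map]
  rintro ⟨i, _, rfl⟩ ⟨j, _, hj⟩; exact hd i j hj.symm

theorem prod_univ_pairing (f : Fin n → ℂ) :
    ∏ k, f k = (∏ i, f (α i) * f (β i)) * ∏ c ∈ unpaired α β, f c := by
  rw [unpaired, ← Finset.prod_mul_prod_compl (Finset.univ.map α ∪ Finset.univ.map β) f,
    Finset.prod_union (disjoint_map_map hd _ _), Finset.prod_map, Finset.prod_map,
    Finset.prod_mul_distrib]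

theorem card_unpaired : (unpaired α β).card + 2 * d = n := by
  have := Finset.card_compl_add_card (Finset.univ.map α ∪ Finset.univ.map β)
  rw [Finset.card_union_of_disjoint (disjoint_map_map hd _ _)] at this
  simp only [Finset.card_map, Finset.card_univ, Fintype.card_fin] at this
  rw [unpaired]; omega

theorem prod_pairedSet (f : Fin n → Bool → ℂ) (x : Finset (Fin d)) {Y : Finset (Fin n)}
    (hY : Y ⊆ unpaired α β) :
    ∏ k, f k (decide (k ∈ pairedSet α β x Y)) =
      (∏ i, f (α i) (decide (i ∈ x)) * f (β i) (decide (i ∉ x))) *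
        ∏ c ∈ unpaired α β, f c (decide (c ∈ Y)) := by
  rw [prod_univ_pairing hd]
  have hα : ∀ i, α i ∈ pairedSet α β x Y ↔ i ∈ x := by
    intro i
    have : α i ∉ Y := fun h => by simpa [unpaired] using hY h
    simp [pairedSet, this, fun j => (hd i j).symm]
  have hβ : ∀ i, β i ∈ pairedSet α β x Y ↔ i ∉ x := by
    intro i
    have : β i ∉ Y := fun h => by simpa [unpaired] using hY h
    simp [pairedSet, this, hd]
  have hC : ∀ c ∈ unpaired α β, (c ∈ pairedSet α β x Y ↔ c ∈ Y) := by
    intro c hc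
    simp only [unpaired, Finset.mem_compl, Finset.mem_union, Finset.mem_map, Finset.mem_univ,
      true_and, not_or, not_exists] at hc
    simp [pairedSet, hc.1, hc.2]
  simp only [hα, hβ]
  congr 1
  refine Finset.prod_congr rfl fun c hc => ?_
  simp only [hC c hc]

/-- Pairing with a product function factors into one `2 × 2` minor for each pair and a sum over the
unpaired labels. -/
theorem sum_prod_mul_pairVec (f : Fin n → Bool → ℂ) (k : ℕ) :
    ∑ Z, (∏ c, f c (decide (c ∈ Z))) * pairVec α β k Z =
      (∏ i, (f (α i) false * f (β i) true - f (α i) true * f (β i) false)) *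
        ∑ Y ∈ (unpaired α β).powersetCard k, ∏ c ∈ unpaired α β, f c (decide (c ∈ Y)) := by
  rw [sum_mul_pairVec]
  have h1 : ∀ x : Finset (Fin d), ∑ Y ∈ (unpaired α β).powersetCard k,
      (-1 : ℂ) ^ x.card * ∏ c, f c (decide (c ∈ pairedSet α β x Y)) =
      ((-1 : ℂ) ^ x.card * ∏ i, f (α i) (decide (i ∈ x)) * f (β i) (decide (i ∉ x))) *
      ∑ Y ∈ (unpaired α β).powersetCard k, ∏ c ∈ unpaired α β, f c (decide (c ∈ Y)) := by
    intro x
    rw [Finset.mul_sum]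
    refine Finset.sum_congr rfl fun Y hY => ?_
    rw [prod_pairedSet hd f x (Finset.mem_powersetCard.1 hY).1, mul_assoc]
  rw [Finset.sum_congr rfl fun x _ => h1 x, ← Finset.sum_mul]
  congr 1
  simp_rw [sub_eq_neg_add]
  rw [Finset.prod_add, Finset.powerset_univ]
  refine Finset.sum_congr rfl fun x _ => ?_
  rw [Finset.prod_neg, mul_assoc, ← Finset.prod_mul_prod_compl x, Finset.compl_eq_univ_sdiff]
  congr 2
  · exact Finset.prod_congr rfl fun i hi => by simp [hi]
  · refine Finset.prod_congr rfl fun i hi => ?_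
    have : i ∉ x := by simpa using hi
    simp [this]

theorem pairVec_apply (k : ℕ) (I : Finset (Fin n)) :
    pairVec α β k I = (∏ i, ((if α i ∉ I ∧ β i ∈ I then 1 else 0) -
      (if α i ∈ I ∧ β i ∉ I then 1 else 0) : ℂ)) *
      if ((unpaired α β).filter fun c => c ∈ I).card = k then 1 else 0 := by
  have h := sum_prod_mul_pairVec hd
    (fun c b => if b = decide (c ∈ I) then (1 : ℂ) else 0) k
  have h1 : ∀ (C Z : Finset (Fin n)),
      (∏ c ∈ C, if decide (c ∈ Z) = decide (c ∈ I) then (1 : ℂ) else 0) =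
      if ∀ c ∈ C, (c ∈ Z ↔ c ∈ I) then 1 else 0 := by
    intro C Z
    rw [Finset.prod_ite_zero]
    simp
  have h2 : ∀ Y ∈ (unpaired α β).powersetCard k, ((∀ c ∈ unpaired α β, (c ∈ Y ↔ c ∈ I)) ↔
      Y = (unpaired α β).filter fun c => c ∈ I) := by
    intro Y hY
    have hY := (Finset.mem_powersetCard.1 hY).1
    constructor
    · intro h; ext c; rw [Finset.mem_filter]
      exact ⟨fun hc => ⟨hY hc, (h c (hY hc)).1 hc⟩, fun hc => (h c hc.1).2 hc.2⟩
    · rintro rfl c hc; simp [hc]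
  have h3 : ∀ Z : Finset (Fin n), (∀ c ∈ Finset.univ, (c ∈ Z ↔ c ∈ I)) ↔ Z = I := by
    intro Z; simp [Finset.ext_iff]
  simp_rw [h1, h3] at h
  rw [Finset.sum_congr rfl fun Y hY => if_congr (h2 Y hY) rfl rfl] at h
  simp only [ite_mul, one_mul, zero_mul, Finset.sum_ite_eq', Finset.mem_univ, if_true,
    Finset.mem_powersetCard, Finset.filter_subset, true_and] at h
  rw [h]
  congr 1
  refine Finset.prod_congr rfl fun i _ => ?_
  by_cases h4 : α i ∈ I <;> by_cases h5 : β i ∈ I <;> simp [h4, h5]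

end Pairing

/-! ### The eigenvalue equation -/

/-- The eigenvalue for `n - 2d` letters and parameter `u - d`, before normalization, times
`4^{-d}` from the `d` singlets and the normalizing constant for `u`, is `λ_d`. -/
theorem eigval_eq {n d : ℕ} (hd : 2 * d ≤ n) (u : ℝ) :
    priorConst u * ((4 ^ d)⁻¹ * (Real.pi * √Real.pi * Real.Gamma (1 - (u - d)) *
      Real.Gamma ((n - 2 * d : ℕ) + 2 - (u - d)) /
        (2 ^ (n - 2 * d) * (Real.Gamma (2 + (n - 2 * d : ℕ) / 2 - (u - d)) *
          Real.Gamma (5 / 2 + (n - 2 * d : ℕ) / 2 - (u - d)))))) = eigval n u d := by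
  have h4 : (2 : ℝ) ^ n = 4 ^ d * 2 ^ (n - 2 * d) := by
    rw [show (4 : ℝ) = 2 ^ 2 by norm_num, ← pow_mul, ← pow_add]; congr 1; omega
  rw [eigval, priorConst, h4, Nat.cast_sub hd]
  push_cast
  rw [show 1 - (u - d) = 1 + d - u by ring,
    show (n : ℝ) - 2 * d + 2 - (u - d) = 2 + n - d - u by ring,
    show 2 + ((n : ℝ) - 2 * d) / 2 - (u - d) = 2 + n / 2 - u by ring,
    show 5 / 2 + ((n : ℝ) - 2 * d) / 2 - (u - d) = 5 / 2 + n / 2 - u by ring]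
  have g2 := (Real.sqrt_pos.2 Real.pi_pos).ne'
  field_simp

/-- At `t = 0` this depends on `u < 1`: then `-(u - d)` is not zero for `d ≥ 1`. -/
theorem pow_mul_rpow_neg {t : ℝ} (ht : 0 ≤ t) {u : ℝ} (hu : u < 1) (d : ℕ) :
    t ^ d * t ^ (-u) = t ^ (-(u - d)) := by
  rcases Nat.eq_zero_or_pos d with rfl | hd
  · simp
  · have : (1 : ℝ) ≤ d := by exact_mod_cast hd
    rw [show -(u - d) = d + -u by ring, Real.rpow_add' ht (by linarith), Real.rpow_natCast]

theorem zeta_mulVec_pairVec {n d : ℕ} {α β : Fin d ↪ Fin n} (hd : ∀ i j, α i ≠ β j)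
    (k : ℕ) {u : ℝ} (hu : u < 1) :
    (zeta n u).mulVec (pairVec α β k) = ((eigval n u d : ℝ) : ℂ) • pairVec α β k := by
  have hud : u - d < 1 := by linarith [d.cast_nonneg (α := ℝ)]
  have hcard := card_unpaired hd
  ext I
  rw [Pi.smul_apply, smul_eq_mul, pairVec_apply hd]
  simp only [Matrix.mulVec, dotProduct]
  set sg : ℂ := ∏ i, ((if α i ∉ I ∧ β i ∈ I then 1 else 0) -
      (if α i ∈ I ∧ β i ∉ I then 1 else 0) : ℂ) with hsg
  have hpt : ∀ w ∈ unitBall, ∑ J, (∏ k, rho w.1 w.2.1 w.2.2 (decide (k ∈ I)) (decide (k ∈ J))) *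
      ((1 - w.1 ^ 2 - w.2.1 ^ 2 - w.2.2 ^ 2) ^ (-u) : ℝ) * pairVec α β k J =
      sg * (4 ^ d)⁻¹ * ∑ Y ∈ (unpaired α β).powersetCard k,
        (∏ c ∈ unpaired α β, rho w.1 w.2.1 w.2.2 (decide (c ∈ I)) (decide (c ∈ Y))) *
        ((1 - w.1 ^ 2 - w.2.1 ^ 2 - w.2.2 ^ 2) ^ (-(u - d)) : ℝ) := by
    rintro ⟨x, y, z⟩ hw
    have h0 : 0 ≤ 1 - x ^ 2 - y ^ 2 - z ^ 2 := by
      have : x ^ 2 + y ^ 2 + z ^ 2 ≤ 1 := hw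
      linarith
    have h := sum_prod_mul_pairVec hd (fun c b => rho x y z (decide (c ∈ I)) b) k
    simp_rw [rho_minor, Finset.prod_mul_distrib, Finset.prod_const] at h
    simp_rw [mul_right_comm _ (((1 - x ^ 2 - y ^ 2 - z ^ 2) ^ (-u) : ℝ) : ℂ)]
    rw [← Finset.sum_mul, h, ← Finset.sum_mul, ← pow_mul_rpow_neg h0 hu d, hsg]
    simp only [decide_eq_false_iff_not, decide_eq_true_eq, Finset.card_univ, Fintype.card_fin]
    push_cast
    rw [div_pow]
    ring
  have hint : ∑ J, zeta n u I J * pairVec α β k J = priorConst u * ∫ w in unitBall, ∑ J,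
      (∏ k, rho w.1 w.2.1 w.2.2 (decide (k ∈ I)) (decide (k ∈ J))) *
      ((1 - w.1 ^ 2 - w.2.1 ^ 2 - w.2.2 ^ 2) ^ (-u) : ℝ) * pairVec α β k J := by
    rw [integral_finsetSum _ fun J _ => (integrableOn_prod_rho _ I J hu).mul_const _,
      Finset.mul_sum]
    refine Finset.sum_congr rfl fun J _ => ?_
    rw [integral_mul_const, zeta_eq, mul_assoc]
  rw [hint, setIntegral_congr_fun measurableSet_unitBall hpt, integral_const_mul,
    integral_finsetSum _ fun Y _ => integrableOn_prod_rho _ I Y hud,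
    sum_integral_prod_rho _ I k hud, ← eigval_eq (by omega) u,
    show n - 2 * d = (unpaired α β).card by omega]
  split_ifs
  · push_cast; ring
  · simp

/-! ### Ballot paths and linear independence -/

theorem card_filter_eq_card_filter_orderEmbOfFin {n d : ℕ} (S : Finset (Fin n)) (h : S.card = d)
    (p : Fin n → Prop) [DecidablePred p] :
    (S.filter p).card = (Finset.univ.filter fun i => p (S.orderEmbOfFin h i)).card := by
  conv_lhs => rw [← S.map_orderEmbOfFin_univ h]
  rw [Finset.filter_map, Finset.card_map]
  rfl

theorem card_filter_lt_orderEmbOfFin {n d : ℕ} (S : Finset (Fin n)) (h : S.card = d) (i : Fin d) :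
    (S.filter fun j => j < S.orderEmbOfFin h i).card = i := by
  simp only [card_filter_eq_card_filter_orderEmbOfFin S h, OrderEmbedding.lt_iff_lt]
  rw [Finset.filter_gt_eq_Iio, Fin.card_Iio]

theorem card_filter_orderEmbOfFin_lt {n d : ℕ} (S : Finset (Fin n)) (h : S.card = d) (i : Fin d) :
    (S.filter fun j => S.orderEmbOfFin h i < j).card = d - 1 - i := by
  simp only [card_filter_eq_card_filter_orderEmbOfFin S h, OrderEmbedding.lt_iff_lt]
  rw [Finset.filter_lt_eq_Ioi, Fin.card_Ioi]

/-- The pairs of the `i`-th largest elements of `A` and `B` are also those of the `i`-th smallest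
ones, as `A` and `B` have the same size. -/
theorem complIn_map {n d : ℕ} {A B : Finset (Fin n)} (hA : A.card = d) (hB : B.card = d)
    (x : Finset (Fin d)) :
    complIn A B (x.map (A.orderEmbOfFin hA).toEmbedding) =
      xᶜ.map (B.orderEmbOfFin hB).toEmbedding := by
  ext b
  rw [complIn, Finset.mem_filter, ← Finset.mem_coe, ← Finset.range_orderEmbOfFin B hB]
  simp only [Set.mem_range, Finset.mem_map, Finset.mem_compl]
  constructor
  · rintro ⟨⟨i, rfl⟩, h⟩
    refine ⟨i, fun hi => h _ ⟨i, hi, rfl⟩ ?_, rfl⟩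
    change (A.filter fun a' => A.orderEmbOfFin hA i < a').card = _
    rw [card_filter_orderEmbOfFin_lt, card_filter_orderEmbOfFin_lt]
  · rintro ⟨i, hi, rfl⟩
    refine ⟨⟨i, rfl⟩, ?_⟩
    rintro _ ⟨j, hj, rfl⟩ h
    change (A.filter fun a' => A.orderEmbOfFin hA j < a').card =
      (B.filter fun b' => B.orderEmbOfFin hB i < b').card at h
    rw [card_filter_orderEmbOfFin_lt, card_filter_orderEmbOfFin_lt] at h
    have : j = i := by ext; omega
    exact hi (this ▸ hj)

theorem vecAB_eq_pairVec {n d : ℕ} (s : ℕ) {A B : Finset (Fin n)} (hA : A.card = d)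
    (hB : B.card = d) :
    vecAB d s A B = pairVec (A.orderEmbOfFin hA).toEmbedding (B.orderEmbOfFin hB).toEmbedding
      (s - d) := by
  rw [vecAB, pairVec]
  symm
  refine Finset.sum_bij (fun x _ => x.map (A.orderEmbOfFin hA).toEmbedding) ?_ ?_ ?_ ?_
  · intro x _
    rw [Finset.mem_powerset]
    conv_rhs => rw [← A.map_orderEmbOfFin_univ hA]
    exact Finset.map_subset_map.2 (Finset.subset_univ x)
  · intro x _ y _ h
    exact Finset.map_injective _ h
  · intro X hX
    rw [Finset.mem_powerset, ← A.map_orderEmbOfFin_univ hA, Finset.subset_map_iff] at hX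
    obtain ⟨x, _, rfl⟩ := hX
    exact ⟨x, Finset.mem_univ _, rfl⟩
  · intro x _
    rw [unpaired, Finset.map_orderEmbOfFin_univ, Finset.map_orderEmbOfFin_univ, Finset.card_map,
      complIn_map hA hB]
    rfl

namespace BallotPath

variable {n d : ℕ}

theorem height_eq (p : Fin n → Bool) (k : ℕ) :
    height p k = ((Finset.univ.filter fun i => p i = true ∧ i.val < k).card : ℤ) -
      (Finset.univ.filter fun i => p i = false ∧ i.val < k).card := by
  rw [height, Finset.sum_ite, Finset.filter_filter, Finset.filter_filter]
  simp [and_comm, sub_eq_add_neg]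

/-- The number of down-steps is determined by the end point; nonnegativity of the final height
bounds it. -/
theorem card_steps (P : BallotPath n d) :
    P.downSet.card = d ∧ 2 * d ≤ n ∧
      (Finset.univ.filter fun i => P.1 i = true).card = n - d := by
  have h1 := P.2.2
  have h2 := P.2.1 n le_rfl
  have h3 := height_eq P.1 n
  have h4 : (Finset.univ.filter fun i => P.1 i = true).card +
      (Finset.univ.filter fun i => P.1 i = false).card = n := by
    have := Finset.card_filter_add_card_filter_not (s := (Finset.univ : Finset (Fin n)))
      (fun i => P.1 i = true)
    simpa using this
  simp only [Fin.is_lt, and_true] at h3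
  rw [downSet]
  omega

theorem mem_downSet (P : BallotPath n d) (i : Fin n) : i ∈ P.downSet ↔ P.1 i = false := by
  simp [downSet]

theorem card_downSet (P : BallotPath n d) : P.downSet.card = d := P.card_steps.1

theorem two_mul_le (P : BallotPath n d) : 2 * d ≤ n := P.card_steps.2.1

theorem card_upSet (P : BallotPath n d) : P.upSet.card = d := by
  obtain ⟨-, h2, h3⟩ := P.card_steps
  set U := Finset.univ.filter fun i => P.1 i = true with hU
  have h4 : P.upSet = U.filter fun i => (U.filter fun j => j < i).card < d := by
    ext i
    simp only [upSet, hU, Finset.mem_filter, Finset.mem_univ, true_and, Finset.filter_filter,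
      and_comm]
  rw [h4, card_filter_eq_card_filter_orderEmbOfFin U h3]
  simp_rw [card_filter_lt_orderEmbOfFin]
  rw [Fin.card_filter_val_lt]
  omega

/-- The labels of the first `d` up-steps, in increasing order. -/
noncomputable def up (P : BallotPath n d) : Fin d ↪ Fin n :=
  (P.upSet.orderEmbOfFin P.card_upSet).toEmbedding

/-- The labels of the down-steps, in increasing order. -/
noncomputable def down (P : BallotPath n d) : Fin d ↪ Fin n :=
  (P.downSet.orderEmbOfFin P.card_downSet).toEmbedding

theorem map_down (P : BallotPath n d) : Finset.univ.map P.down = P.downSet :=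
  Finset.map_orderEmbOfFin_univ _ _

theorem vec_eq (s : ℕ) (P : BallotPath n d) : vec s P = pairVec P.up P.down (s - d) :=
  vecAB_eq_pairVec s P.card_upSet P.card_downSet

theorem up_mem (P : BallotPath n d) (i : Fin d) : P.up i ∈ P.upSet :=
  Finset.orderEmbOfFin_mem _ _ i

theorem down_mem (P : BallotPath n d) (i : Fin d) : P.down i ∈ P.downSet :=
  Finset.orderEmbOfFin_mem _ _ i

theorem up_ne_down (P : BallotPath n d) (i j : Fin d) : P.up i ≠ P.down j := by
  intro h
  have h1 := P.up_mem i
  have h2 := P.down_mem j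
  rw [h] at h1
  simp only [upSet, downSet, Finset.mem_filter, Finset.mem_univ, true_and] at h1 h2
  simp [h2] at h1

/-- The `i`-th up-step precedes the `i`-th down-step; otherwise the path would be below the axis
right after this down-step. -/
theorem up_lt_down (P : BallotPath n d) (i : Fin d) : P.up i < P.down i := by
  refine lt_of_le_of_ne ?_ (P.up_ne_down i i)
  by_contra! h
  have h1 := P.2.1 ((P.down i).val + 1) (P.down i).isLt
  rw [height_eq] at h1
  have h2 : (Finset.univ.filter fun j => P.1 j = true ∧ j.val < (P.down i).val + 1).card ≤ i := by
    rw [← card_filter_lt_orderEmbOfFin P.upSet P.card_upSet i]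
    refine Finset.card_le_card fun j hj => ?_
    simp only [Finset.mem_filter, Finset.mem_univ, true_and] at hj ⊢
    have hji : j < P.up i := lt_of_le_of_lt (Fin.le_def.2 (by omega)) h
    refine ⟨?_, hji⟩
    have hu := P.up_mem i
    simp only [upSet, Finset.mem_filter, Finset.mem_univ, true_and] at hu ⊢
    refine ⟨hj.1, lt_of_le_of_lt (Finset.card_le_card fun l hl => ?_) hu.2⟩
    simp only [Finset.mem_filter, Finset.mem_univ, true_and] at hl ⊢
    exact ⟨hl.1.trans hji, hl.2⟩
  have h3 : (i : ℕ) + 1 ≤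
      (Finset.univ.filter fun j => P.1 j = false ∧ j.val < (P.down i).val + 1).card := by
    rw [← card_filter_lt_orderEmbOfFin P.downSet P.card_downSet i,
      ← Finset.card_insert_of_notMem (a := P.down i) (by simp [down])]
    refine Finset.card_le_card fun j hj => ?_
    have hd := P.down_mem i
    simp only [Finset.mem_insert, Finset.mem_filter, Finset.mem_univ, true_and,
      mem_downSet] at hj hd ⊢
    rcases hj with rfl | ⟨hj1, hj2⟩
    · exact ⟨hd, by omega⟩
    · exact ⟨hj1, (Fin.lt_def.1 hj2).trans (Nat.lt_succ_self _)⟩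
  omega

theorem downSet_injective : Function.Injective (downSet : BallotPath n d → Finset (Fin n)) := by
  intro P Q h
  refine Subtype.ext (funext fun i => ?_)
  have := Finset.ext_iff.1 h i
  simp only [downSet, Finset.mem_filter, Finset.mem_univ, true_and] at this
  cases h1 : P.1 i <;> cases h2 : Q.1 i <;> simp_all

end BallotPath

section Superset

variable {n d : ℕ} {α β : Fin d ↪ Fin n} (hd : ∀ i j, α i ≠ β j)
include hd

theorem card_pairedSet (x : Finset (Fin d)) {Y : Finset (Fin n)} (hY : Y ⊆ unpaired α β) :
    (pairedSet α β x Y).card = d + Y.card := by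
  rw [pairedSet, Finset.card_union_of_disjoint, Finset.card_union_of_disjoint, Finset.card_map,
    Finset.card_map, Finset.card_add_card_compl, Fintype.card_fin]
  · exact disjoint_map_map hd _ _
  · rw [Finset.disjoint_left]
    intro a ha h
    have := hY h
    simp only [unpaired, Finset.mem_compl, Finset.mem_union, Finset.mem_map, Finset.mem_univ,
      true_and] at this ha
    rcases ha with ⟨i, _, rfl⟩ | ⟨i, _, rfl⟩
    · exact this (Or.inl ⟨i, rfl⟩)
    · exact this (Or.inr ⟨i, rfl⟩)

/-- The sum of the coordinates of `pairVec` at the supersets of `T` of size `s`. It vanishes as soon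
as some pair is disjoint from `T` or contained in `T`. -/
theorem sum_superset_mul_pairVec (T : Finset (Fin n)) (s k : ℕ) :
    ∑ Z, (if T ⊆ Z ∧ Z.card = s then 1 else 0) * pairVec α β k Z =
      if d + k = s then (∏ i, ((if α i ∈ T then 0 else 1) - (if β i ∈ T then 0 else 1) : ℂ)) *
        (((unpaired α β).powersetCard k).filter fun Y => unpaired α β ∩ T ⊆ Y).card else 0 := by
  have h1 : ∑ Z, (if T ⊆ Z ∧ Z.card = s then 1 else 0) * pairVec α β k Z =
      if d + k = s then ∑ Z, (if T ⊆ Z then 1 else 0) * pairVec α β k Z else 0 := by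
    have h2 : ∀ x, ∀ Y ∈ (unpaired α β).powersetCard k,
        (pairedSet α β x Y).card = d + k := by
      intro x Y hY
      rw [Finset.mem_powersetCard] at hY
      rw [card_pairedSet hd x hY.1, hY.2]
    rw [sum_mul_pairVec, sum_mul_pairVec]
    split_ifs with h
    · refine Finset.sum_congr rfl fun x _ => Finset.sum_congr rfl fun Y hY => ?_
      simp [h2 x Y hY, h]
    · refine Finset.sum_eq_zero fun x _ => Finset.sum_eq_zero fun Y hY => ?_
      simp [h2 x Y hY, h]
  rw [h1]
  split_ifs with h
  · have h3 : ∀ C Z : Finset (Fin n), (if C ∩ T ⊆ Z then (1 : ℂ) else 0) =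
        ∏ c ∈ C, if c ∈ T then (if decide (c ∈ Z) = true then 1 else 0) else 1 := by
      intro C Z
      have : ∀ c, (if c ∈ T then (if decide (c ∈ Z) = true then (1 : ℂ) else 0) else 1) =
          if c ∈ T → c ∈ Z then 1 else 0 := by
        intro c; by_cases h1 : c ∈ T <;> by_cases h2 : c ∈ Z <;> simp [h1, h2]
      simp_rw [this]
      rw [Finset.prod_ite_zero]
      simp [Finset.subset_iff]
    have h4 := h3 Finset.univ
    simp only [Finset.univ_inter] at h4
    simp_rw [h4]
    rw [sum_prod_mul_pairVec hd
      (fun c b => if c ∈ T then (if b = true then 1 else 0) else 1) k]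
    simp_rw [← h3]
    rw [Finset.sum_boole]
    congr 1
    refine Finset.prod_congr rfl fun i _ => ?_
    by_cases h5 : α i ∈ T <;> by_cases h6 : β i ∈ T <;> simp [h5, h6]
  · rfl

end Superset

namespace BallotPath

variable {n d e : ℕ}

/-- The functional that sums the coordinates at all supersets of size `s` of the set of
down-steps. -/
noncomputable def supersetSum (s : ℕ) (P : BallotPath n d) : (Finset (Fin n) → ℂ) →ₗ[ℂ] ℂ where
  toFun v := ∑ Z, (if P.downSet ⊆ Z ∧ Z.card = s then 1 else 0) * v Z
  map_add' v w := by simp [mul_add, Finset.sum_add_distrib]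
  map_smul' c v := by
    simp only [Pi.smul_apply, smul_eq_mul, RingHom.id_apply, Finset.mul_sum]
    exact Finset.sum_congr rfl fun Z _ => by ring

theorem supersetSum_vec_self (P : BallotPath n d) {s : ℕ} (hds : d ≤ s) (hsd : s + d ≤ n) :
    P.supersetSum s (vec s P) ≠ 0 := by
  have hcard := card_unpaired P.up_ne_down
  have hα : ∀ i, P.up i ∉ P.downSet := by
    intro i; rw [← P.map_down]; simp [fun j => (P.up_ne_down i j).symm]
  change ∑ Z, _ * vec s P Z ≠ 0
  rw [vec_eq, sum_superset_mul_pairVec P.up_ne_down, if_pos (by omega)]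
  have hempty : unpaired P.up P.down ∩ P.downSet = ∅ := by
    ext a; rw [← P.map_down, unpaired]; simp
  simp only [hα, P.down_mem, if_true, if_false, sub_zero, Finset.prod_const_one, one_mul,
    hempty, Finset.empty_subset, Finset.filter_true, Finset.card_powersetCard]
  exact_mod_cast (Nat.choose_pos (by omega)).ne'

/-- The triangularity of the tests: if the functional of `P` does not vanish on the vector of `Q`,
then the down-steps of `P` form a transversal of the pairs of `Q`, plus `d - e` further labels. -/
theorem of_supersetSum_vec_ne_zero (P : BallotPath n d) (Q : BallotPath n e) {s t : ℕ} (het : e ≤ t)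
    (h : P.supersetSum s (vec t Q) ≠ 0) :
    t = s ∧ (e < d ∨ e = d ∧ (Q.downSet = P.downSet ∨
      ∑ a ∈ P.downSet, a.val < ∑ a ∈ Q.downSet, a.val)) := by
  change ∑ Z, _ * vec t Q Z ≠ 0 at h
  rw [vec_eq, sum_superset_mul_pairVec Q.up_ne_down, Ne, ite_eq_right_iff, Classical.not_imp,
    mul_eq_zero, not_or, ← Ne, Finset.prod_ne_zero_iff] at h
  obtain ⟨hs, h, -⟩ := h
  refine ⟨by omega, ?_⟩
  -- the element of each pair of `Q` that lies in the set of down-steps of `P`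
  have h1 : ∀ i, ∃ a, a ∈ P.downSet ∧ (a = Q.up i ∨ a = Q.down i) := by
    intro i
    have := h i (Finset.mem_univ i)
    by_cases h2 : Q.up i ∈ P.downSet
    · exact ⟨_, h2, Or.inl rfl⟩
    · by_cases h3 : Q.down i ∈ P.downSet
      · exact ⟨_, h3, Or.inr rfl⟩
      · simp [h2, h3] at this
  choose γ hγ hγ' using h1
  have hinj : Function.Injective γ := by
    intro i j hij
    rcases hγ' i with hi | hi <;> rcases hγ' j with hj | hj <;> rw [hi, hj] at hij
    · exact Q.up.injective hij
    · exact absurd hij (Q.up_ne_down i j)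
    · exact absurd hij.symm (Q.up_ne_down j i)
    · exact Q.down.injective hij
  have hsub : Finset.univ.map ⟨γ, hinj⟩ ⊆ P.downSet := by
    intro a; simp only [Finset.mem_map, Finset.mem_univ, true_and]
    rintro ⟨i, rfl⟩; exact hγ i
  have hle := Finset.card_le_card hsub
  rw [Finset.card_map, Finset.card_univ, Fintype.card_fin, P.card_downSet] at hle
  rcases hle.lt_or_eq with hlt | heq
  · exact Or.inl hlt
  · refine Or.inr ⟨heq, ?_⟩
    have hP : Finset.univ.map ⟨γ, hinj⟩ = P.downSet := by
      refine Finset.eq_of_subset_of_card_le hsub ?_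
      rw [Finset.card_map, Finset.card_univ, Fintype.card_fin, P.card_downSet, heq]
    have hγle : ∀ i, γ i ≤ Q.down i := by
      intro i
      rcases hγ' i with hi | hi <;> rw [hi]
      exact (Q.up_lt_down i).le
    by_cases hall : ∀ i, γ i = Q.down i
    · left
      rw [← hP, ← Q.map_down]
      congr 1
      ext i; simp [hall i]
    · right
      push Not at hall
      obtain ⟨i, hi⟩ := hall
      rw [← hP, ← Q.map_down, Finset.sum_map, Finset.sum_map]
      exact Finset.sum_lt_sum (fun j _ => Fin.le_def.1 (hγle j))
        ⟨i, Finset.mem_univ i, Fin.lt_def.1 (lt_of_le_of_ne (hγle i) hi)⟩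

end BallotPath

/-- A family is linearly independent if it has a triangular matrix, with nonzero diagonal entries,
against a family of linear functionals. -/
theorem linearIndependent_of_triangular {ι K V R : Type*} [Field K] [AddCommGroup V] [Module K V]
    [LinearOrder R] (v : ι → V) (f : ι → V →ₗ[K] K) (r : ι → R) (hdiag : ∀ i, f i (v i) ≠ 0)
    (htri : ∀ i j, f i (v j) ≠ 0 → j = i ∨ r j < r i) : LinearIndependent K v := by
  classical
  rw [linearIndependent_iff']
  intro s c hc
  by_contra! hne
  obtain ⟨i₀, hi₀, hci₀⟩ := hne
  obtain ⟨i, hi, hmin⟩ := Finset.exists_min_image (s.filter fun i => c i ≠ 0) r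
    ⟨i₀, Finset.mem_filter.2 ⟨hi₀, hci₀⟩⟩
  rw [Finset.mem_filter] at hi
  have h := congrArg (f i) hc
  rw [map_sum, map_zero, Finset.sum_eq_single i] at h
  · rw [map_smul, smul_eq_mul, mul_eq_zero] at h
    exact h.elim hi.2 (hdiag i)
  · intro j hj hji
    rw [map_smul, smul_eq_mul, mul_eq_zero]
    by_contra! h2
    have h3 := (htri i j h2.2).resolve_left hji
    exact absurd (hmin j (Finset.mem_filter.2 ⟨hj, h2.1⟩)) (not_le.2 h3)
  · intro h2; exact absurd hi.1 h2

theorem linearIndependent_vec (n : ℕ) : LinearIndependent ℂ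
    (fun i : Index n => vec (i.2.1 : ℕ) i.2.2) := by
  refine linearIndependent_of_triangular _ (fun i : Index n => i.2.2.supersetSum i.2.1)
    (fun i => toLex ((i.1 : ℕ), OrderDual.toDual (∑ a ∈ i.2.2.downSet, a.val))) ?_ ?_
  · rintro ⟨d, ⟨s, hs⟩, P⟩
    have := P.two_mul_le
    have h2 : s ≤ n - d := hs.2
    change P.supersetSum s (vec s P) ≠ 0
    exact P.supersetSum_vec_self hs.1 (by omega)
  · rintro ⟨d, ⟨s, hs⟩, P⟩ ⟨e, ⟨t, ht⟩, Q⟩ h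
    change P.supersetSum s (vec t Q) ≠ 0 at h
    obtain ⟨hst, h'⟩ := P.of_supersetSum_vec_ne_zero Q ht.1 h
    rcases h' with h' | ⟨hed, h'⟩
    · right
      exact Prod.Lex.toLex_lt_toLex.2 (Or.inl h')
    · obtain rfl : e = d := Fin.ext hed
      obtain rfl : t = s := hst
      rcases h' with h' | h'
      · left
        rw [BallotPath.downSet_injective h']
      · right
        exact Prod.Lex.toLex_lt_toLex.2 (Or.inr ⟨rfl, h'⟩)

/-! ### Counting ballot paths and the eigenspaces -/

theorem height_snoc_of_le {n : ℕ} (p : Fin n → Bool) (b : Bool) {k : ℕ} (hk : k ≤ n) :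
    height (Fin.snoc p b : Fin (n + 1) → Bool) k = height p k := by
  simp only [height, Finset.sum_filter, Fin.sum_univ_castSucc, Fin.snoc_castSucc, Fin.val_castSucc,
    Fin.val_last, not_lt.2 hk, if_false, add_zero]

theorem height_snoc_last {n : ℕ} (p : Fin n → Bool) (b : Bool) :
    height (Fin.snoc p b : Fin (n + 1) → Bool) (n + 1) =
      height p n + if b = true then 1 else -1 := by
  simp only [height, Finset.sum_filter, Fin.sum_univ_castSucc, Fin.snoc_castSucc, Fin.snoc_last,
    if_true, Fin.is_lt]

namespace BallotPath

instance (n d : ℕ) : Finite (BallotPath n d) :=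
  inferInstanceAs (Finite {p : Fin n → Bool // (∀ k ≤ n, 0 ≤ height p k) ∧
    height p n = (n : ℤ) - 2 * d})

/-- The extension of a ballot path by one step. -/
def snoc {n d e : ℕ} (b : Bool) (P : BallotPath n d) (he : 2 * e ≤ n + 1)
    (h : (d : ℤ) = if b = true then (e : ℤ) else (e : ℤ) - 1) : BallotPath (n + 1) e := by
  refine ⟨Fin.snoc P.1 b, ?_, ?_⟩
  · intro k hk
    rcases Nat.lt_or_ge n k with h1 | h1
    · obtain rfl : k = n + 1 := by omega
      rw [height_snoc_last, P.2.2]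
      split_ifs at h ⊢ <;> omega
    · rw [height_snoc_of_le _ _ h1]; exact P.2.1 k h1
  · rw [height_snoc_last, P.2.2]
    push_cast
    split_ifs at h ⊢ <;> omega

theorem exists_eq_snoc {n e : ℕ} (P : BallotPath (n + 1) e) :
    ∃ p : Fin n → Bool, ∃ b : Bool, P.1 = Fin.snoc p b ∧ (∀ k ≤ n, 0 ≤ height p k) ∧
      height p n = (n : ℤ) - 2 * (if b = true then e else e - 1 : ℤ) := by
  refine ⟨Fin.init P.1, P.1 (Fin.last n), (Fin.snoc_init_self P.1).symm, ?_, ?_⟩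
  · intro k hk
    rw [← height_snoc_of_le _ (P.1 (Fin.last n)) hk, Fin.snoc_init_self]
    exact P.2.1 k (by omega)
  · have h := height_snoc_last (Fin.init P.1) (P.1 (Fin.last n))
    rw [Fin.snoc_init_self, P.2.2] at h
    push_cast at h
    split_ifs at h ⊢ <;> omega

theorem card_zero_right (n : ℕ) : Nat.card (BallotPath n 0) = 1 := by
  rw [Nat.card_eq_one_iff_unique]
  have h : ∀ P : BallotPath n 0, ∀ i, P.1 i = true := by
    intro P i
    have := P.card_downSet
    rw [Finset.card_eq_zero] at this
    by_contra h
    have h2 := (P.mem_downSet i).2 (by simpa using h)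
    simp [this] at h2
  refine ⟨⟨fun P Q => Subtype.ext (funext fun i => (h P i).trans (h Q i).symm)⟩,
    ⟨⟨fun _ => true, ?_, ?_⟩⟩⟩
  · intro k _; simp [height]
  · simp [height]

theorem card_succ_succ {n d : ℕ} (h : 2 * (d + 1) ≤ n + 1) :
    Nat.card (BallotPath (n + 1) (d + 1)) =
      Nat.card (BallotPath n (d + 1)) + Nat.card (BallotPath n d) := by
  rw [← Nat.card_sum]
  symm
  refine Nat.card_congr (Equiv.ofBijective (Sum.elim (fun P => snoc true P h (by simp))
    (fun P => snoc false P h (by simp))) ⟨?_, ?_⟩)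
  · have key : ∀ (b c : Bool) (p q : Fin n → Bool),
        (Fin.snoc p b : Fin (n + 1) → Bool) = Fin.snoc q c → p = q ∧ b = c :=
      fun b c p q h => Fin.snoc_inj.1 h
    rintro (P | P) (Q | Q) hPQ <;> 
      have h2 := key _ _ _ _ (congrArg Subtype.val hPQ)
    · rw [Subtype.ext h2.1]
    · exact absurd h2.2 (by simp)
    · exact absurd h2.2 (by simp)
    · rw [Subtype.ext h2.1]
  · intro P
    obtain ⟨p, b, hp, h1, h2⟩ := P.exists_eq_snoc
    cases b
    · refine ⟨Sum.inr ⟨p, h1, ?_⟩, Subtype.ext hp.symm⟩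
      rw [h2]; simp
    · exact ⟨Sum.inl ⟨p, h1, h2⟩, Subtype.ext hp.symm⟩

/-- The ballot numbers: the number of ballot paths is `C(n, d + 1) - C(n, d)`. The case
`2 (d + 1) = n + 1`, in which there is no path, as its end point would be below the axis, is needed
in the induction. -/
theorem card_add_choose (n : ℕ) : ∀ d : ℕ, 2 * (d + 1) ≤ n + 1 →
    Nat.card (BallotPath n (d + 1)) + n.choose d = n.choose (d + 1) := by
  induction n with
  | zero => intro d h; omega
  | succ n ih =>
    intro d h
    rcases Nat.lt_or_ge (n + 1) (2 * (d + 1)) with h1 | h1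
    · have : IsEmpty (BallotPath (n + 1) (d + 1)) := ⟨fun P => by have := P.two_mul_le; omega⟩
      rw [Nat.card_of_isEmpty, zero_add]
      obtain rfl : n = 2 * d := by omega
      exact (Nat.choose_symm_half d).symm
    · rw [card_succ_succ h1, Nat.choose_succ_succ' n d]
      have h2 := ih d h1
      cases d with
      | zero => rw [card_zero_right]; simp at h2 ⊢; omega
      | succ d =>
        have h3 := ih d (by omega)
        rw [Nat.choose_succ_succ' n d]
        omega

theorem sum_card {n : ℕ} : ∀ s : ℕ, 2 * s ≤ n + 1 →
    ∑ d ∈ Finset.range (s + 1), Nat.card (BallotPath n d) = n.choose s := by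
  intro s
  induction s with
  | zero => intro _; simp [card_zero_right]
  | succ s ih =>
    intro h
    rw [Finset.sum_range_succ, ih (by omega), ← card_add_choose n s h, add_comm]

theorem succ_mul_card {n d : ℕ} (h : 2 * d ≤ n) :
    ((n : ℚ) + 1) * Nat.card (BallotPath n d) = (n - 2 * d + 1) * (n + 1).choose d := by
  cases d with
  | zero => simp [card_zero_right]
  | succ d =>
    have h1 : ((Nat.card (BallotPath n (d + 1)) : ℕ) : ℚ) + n.choose d = n.choose (d + 1) := by
      exact_mod_cast card_add_choose n d (by omega)
    have h2 : (n.choose (d + 1) : ℚ) * (d + 1) = n.choose d * (n - d) := by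
      have := Nat.choose_succ_right_eq n d
      rw [← Nat.cast_sub (by omega : d ≤ n)]
      exact_mod_cast this
    rw [Nat.choose_succ_succ]
    push_cast
    rw [← h1] at h2 ⊢
    linear_combination 2 * h2

end BallotPath

theorem card_fiber (n d : ℕ) :
    Nat.card (Set.Icc d (n - d) × BallotPath n d) =
      (n - d + 1 - d) * Nat.card (BallotPath n d) := by
  rw [Nat.card_prod]; simp

/-- For a fixed weight `s` the numbers of ballot paths with `d ≤ min s (n - s)` telescope to
`C(n, s)`. -/
theorem card_index (n : ℕ) : Nat.card (Index n) = 2 ^ n := by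
  rw [Nat.card_sigma]
  simp_rw [card_fiber]
  rw [Fin.sum_univ_eq_sum_range (fun d => (n - d + 1 - d) * Nat.card (BallotPath n d))]
  have h : ∀ d, (n - d + 1 - d) * Nat.card (BallotPath n d) =
      ∑ s ∈ Finset.Icc d (n - d), Nat.card (BallotPath n d) := by
    intro d; simp
  simp_rw [h]
  rw [Finset.sum_comm' (t' := Finset.range (n + 1))
    (s' := fun s => Finset.range (min s (n - s) + 1)), ← Nat.sum_range_choose]
  · refine Finset.sum_congr rfl fun s hs => ?_
    rw [Finset.mem_range] at hs
    rw [BallotPath.sum_card _ (by omega)]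
    rcases le_total s (n - s) with h1 | h1
    · rw [min_eq_left h1]
    · rw [min_eq_right h1, Nat.choose_symm (by omega)]
  · intro d s
    simp only [Finset.mem_range, Finset.mem_Icc]
    omega

theorem eigval_strictAntiOn (n : ℕ) {u : ℝ} (hu : u < 1) :
    StrictAntiOn (eigval n u) (Set.Iic (n / 2)) := by
  refine strictAntiOn_of_succ_lt Set.ordConnected_Iic ?_
  intro d _ _ hd
  rw [Nat.succ_eq_succ, Set.mem_Iic] at hd
  have hdn : (2 : ℝ) * d + 2 ≤ n := by exact_mod_cast (by omega : 2 * d + 2 ≤ n)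
  have h0 : (0 : ℝ) ≤ d := d.cast_nonneg
  have p1 : 0 < 1 + (n : ℝ) - d - u := by linarith
  have p2 : 0 < 1 + (d : ℝ) - u := by linarith
  have e1 : Real.Gamma (2 + n - d - u) = (1 + n - d - u) * Real.Gamma (1 + n - d - u) := by
    rw [← Real.Gamma_add_one p1.ne']; congr 1; ring
  have e2 : Real.Gamma (1 + (d + 1 : ℕ) - u) = (1 + d - u) * Real.Gamma (1 + d - u) := by
    rw [← Real.Gamma_add_one p2.ne']; congr 1; push_cast; ring
  have g1 := Real.Gamma_pos_of_pos p1
  have g2 := Real.Gamma_pos_of_pos p2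
  have g3 := Real.Gamma_pos_of_pos (show 0 < 5 / 2 - u by linarith)
  have g4 := Real.Gamma_pos_of_pos (show 0 < 5 / 2 + (n : ℝ) / 2 - u by linarith)
  have g5 := Real.Gamma_pos_of_pos (show 0 < 2 + (n : ℝ) / 2 - u by linarith)
  have g6 := Real.Gamma_pos_of_pos (show 0 < 1 - u by linarith)
  rw [Nat.succ_eq_succ, eigval, eigval]
  refine div_lt_div_of_pos_right (mul_lt_mul_of_pos_left ?_ (by positivity)) (by positivity)
  rw [Nat.succ_eq_add_one, e1, e2,
    show 2 + (n : ℝ) - (d + 1 : ℕ) - u = 1 + n - d - u by push_cast; ring]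
  have : 0 < Real.Gamma (5 / 2 - u) * Real.Gamma (1 + n - d - u) * Real.Gamma (1 + d - u) := by
    positivity
  nlinarith

/-- An endomorphism with a basis of eigenvectors has as eigenspaces the spans of the basis vectors
with the given eigenvalue. -/
theorem eigenspace_eq_span_image {ι K V : Type*} [Field K] [AddCommGroup V] [Module K V]
    (b : Module.Basis ι K V) (f : Module.End K V) (l : ι → K) (h : ∀ i, f (b i) = l i • b i)
    (μ : K) : Module.End.eigenspace f μ = Submodule.span K (b '' {i | l i = μ}) := by
  apply le_antisymm
  · intro v hv
    rw [Module.End.mem_eigenspace_iff] at hv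
    rw [Module.Basis.mem_span_image]
    intro i hi
    have h1 : b.coord i ∘ₗ f = l i • b.coord i := by
      refine b.ext fun j => ?_
      rw [LinearMap.comp_apply, h, map_smul, LinearMap.smul_apply, b.coord_apply, b.repr_self]
      by_cases hij : j = i
      · rw [hij]
      · simp [hij]
    have h2 := LinearMap.congr_fun h1 v
    rw [LinearMap.comp_apply, hv, map_smul, LinearMap.smul_apply, smul_eq_mul, smul_eq_mul] at h2
    exact (mul_right_cancel₀ (Finsupp.mem_support_iff.1 hi) h2).symm
  · rw [Submodule.span_le]
    rintro _ ⟨i, rfl, rfl⟩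
    exact Module.End.mem_eigenspace_iff.2 (h i)

theorem toLin'_vec {n d : ℕ} {u : ℝ} (hu : u < 1) (s : ℕ) (P : BallotPath n d) :
    Matrix.toLin' (zeta n u) (vec s P) = ((eigval n u d : ℝ) : ℂ) • vec s P := by
  rw [Matrix.toLin'_apply, P.vec_eq, zeta_mulVec_pairVec P.up_ne_down _ hu]

theorem span_range_vec (n : ℕ) :
    Submodule.span ℂ (Set.range (fun i : Index n => vec (i.2.1 : ℕ) i.2.2)) = ⊤ := by
  have := Fintype.ofFinite (Index n)
  refine (linearIndependent_vec n).span_eq_top_of_card_eq_finrank' ?_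
  rw [← Nat.card_eq_fintype_card, card_index]
  simp

/-- The basis of all vectors `v_{d,s}(P)`. -/
noncomputable def vecBasis (n : ℕ) : Module.Basis (Index n) ℂ (Finset (Fin n) → ℂ) :=
  .mk (linearIndependent_vec n) (span_range_vec n).ge

theorem vecBasis_apply {n : ℕ} (i : Index n) : vecBasis n i = vec (i.2.1 : ℕ) i.2.2 := by
  rw [vecBasis, Module.Basis.mk_apply]

theorem eigenspace_zeta (n : ℕ) {u : ℝ} (hu : u < 1) (μ : ℂ) :
    Module.End.eigenspace (Matrix.toLin' (zeta n u)) μ =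
      Submodule.span ℂ (vecBasis n '' {i | ((eigval n u i.1 : ℝ) : ℂ) = μ}) := by
  refine eigenspace_eq_span_image (vecBasis n) _ (fun i => ((eigval n u i.1 : ℝ) : ℂ)) ?_ μ
  intro i
  rw [vecBasis_apply, toLin'_vec hu]

theorem eigenspace_eigval {n d : ℕ} {u : ℝ} (hu : u < 1) (hd : d ≤ n / 2) :
    Module.End.eigenspace (Matrix.toLin' (zeta n u)) ((eigval n u d : ℝ) : ℂ) =
      Submodule.span ℂ (Set.range fun x : Set.Icc d (n - d) × BallotPath n d =>
        vec (x.1 : ℕ) x.2) := by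
  rw [eigenspace_zeta n hu]
  congr 1
  ext v
  constructor
  · rintro ⟨⟨⟨e, he⟩, x⟩, hi, rfl⟩
    have hi : eigval n u e = eigval n u d := Complex.ofReal_injective hi
    obtain rfl := (eigval_strictAntiOn n hu).injOn (Nat.lt_succ_iff.1 he) hd hi
    exact ⟨x, (vecBasis_apply (⟨⟨e, he⟩, x⟩ : Index n)).symm⟩
  · rintro ⟨x, rfl⟩
    refine ⟨(⟨⟨d, Nat.lt_succ_iff.2 hd⟩, x⟩ : Index n), ?_, ?_⟩
    · exact Eq.refl ((eigval n u d : ℝ) : ℂ)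
    · rw [vecBasis_apply]

theorem finrank_eigenspace {n d : ℕ} {u : ℝ} (hu : u < 1) (hd : d ≤ n / 2) :
    Module.finrank ℂ (Module.End.eigenspace (Matrix.toLin' (zeta n u))
      ((eigval n u d : ℝ) : ℂ)) = (n - d + 1 - d) * Nat.card (BallotPath n d) := by
  have := Fintype.ofFinite (Set.Icc d (n - d) × BallotPath n d)
  rw [eigenspace_eigval hu hd, ← card_fiber, Nat.card_eq_fintype_card]
  refine finrank_span_eq_card ?_
  exact (linearIndependent_vec n).comp
    (fun x : Set.Icc d (n - d) × BallotPath n d =>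
      (⟨⟨d, Nat.lt_succ_iff.2 hd⟩, x⟩ : Index n)) fun x y h => eq_of_heq (Sigma.mk.inj h).2

theorem vec_ne_zero {n d s : ℕ} (hds : d ≤ s) (hsd : s + d ≤ n) (P : BallotPath n d) :
    vec s P ≠ 0 := by
  intro h
  exact P.supersetSum_vec_self hds hsd (by rw [h, map_zero])

end BayesDensity

theorem theorem2 (n : ℕ) (u : ℝ) (hu : u < 1) :
    -- the entries of the average are given by the explicit formula
    (∀ I J : Finset (Fin n),
      BayesDensity.zeta n u I J = ((BayesDensity.entry n u I J : ℝ) : ℂ)) ∧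
    -- the eigenvalues are exactly the numbers `λ_d` with `0 ≤ d ≤ ⌊n/2⌋`
    (∀ μ : ℂ, Module.End.HasEigenvalue (Matrix.toLin' (BayesDensity.zeta n u)) μ ↔
      ∃ d : ℕ, d ≤ n / 2 ∧ μ = ((BayesDensity.eigval n u d : ℝ) : ℂ)) ∧
    -- these numbers are distinct
    (∀ d ≤ n / 2, ∀ d' ≤ n / 2,
      BayesDensity.eigval n u d = BayesDensity.eigval n u d' → d = d') ∧
    -- the multiplicities
    (∀ d ≤ n / 2,
      (Module.finrank ℂ (Module.End.eigenspace (Matrix.toLin' (BayesDensity.zeta n u))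
          ((BayesDensity.eigval n u d : ℝ) : ℂ)) : ℚ) =
        ((n : ℚ) - 2 * d + 1) ^ 2 / (n + 1) * (n + 1).choose d) ∧
    -- `v_{d,s}(P)` is an eigenvector for the eigenvalue `λ_d`
    (∀ d s : ℕ, d ≤ s → s + d ≤ n → ∀ P : BayesDensity.BallotPath n d,
      Module.End.HasEigenvector (Matrix.toLin' (BayesDensity.zeta n u))
        ((BayesDensity.eigval n u d : ℝ) : ℂ) (BayesDensity.vec s P)) ∧
    -- for each `d`, the vectors `v_{d,s}(P)` span the eigenspace of `λ_d`
    (∀ d ≤ n / 2,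
      Submodule.span ℂ {v | ∃ s : ℕ, d ≤ s ∧ s + d ≤ n ∧
          ∃ P : BayesDensity.BallotPath n d, v = BayesDensity.vec s P} =
        Module.End.eigenspace (Matrix.toLin' (BayesDensity.zeta n u))
          ((BayesDensity.eigval n u d : ℝ) : ℂ)) ∧
    -- all the vectors `v_{d,s}(P)` together form a basis of the whole space
    LinearIndependent ℂ
      (fun i : BayesDensity.Index n => BayesDensity.vec (i.2.1 : ℕ) i.2.2) ∧
    Submodule.span ℂ
      (Set.range (fun i : BayesDensity.Index n => BayesDensity.vec (i.2.1 : ℕ) i.2.2)) = ⊤ := by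
  open BayesDensity in
  have hvec : ∀ d s : ℕ, d ≤ s → s + d ≤ n → ∀ P : BallotPath n d,
      Module.End.HasEigenvector (Matrix.toLin' (zeta n u)) ((eigval n u d : ℝ) : ℂ) (vec s P) :=
    fun d s hds hsd P => ⟨Module.End.mem_eigenspace_iff.2 (toLin'_vec hu s P),
      vec_ne_zero hds hsd P⟩
  open BayesDensity in
  refine ⟨zeta_eq_entry n hu, fun μ => ⟨fun hμ => ?_, ?_⟩,
    fun d hd d' hd' h => (eigval_strictAntiOn n hu).injOn hd hd' h, fun d hd => ?_, hvec,
    fun d hd => ?_, linearIndependent_vec n, span_range_vec n⟩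
  · by_contra! hne
    refine hμ ?_
    have hempty : {i : Index n | ((eigval n u i.1 : ℝ) : ℂ) = μ} = ∅ :=
      Set.eq_empty_of_forall_notMem fun i hi => hne i.1 (Nat.lt_succ_iff.1 i.1.2) hi.symm
    rw [← Module.End.eigenspace, eigenspace_zeta n hu, hempty, Set.image_empty,
      Submodule.span_empty]
  · rintro ⟨d, hd, rfl⟩
    have hpos : 0 < Nat.card (BallotPath n d) := by
      have h1 := BallotPath.succ_mul_card (n := n) (d := d) (by omega)
      have h2 : (0 : ℚ) < (n - 2 * d + 1) * (n + 1).choose d := by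
        have h3 : (2 * d : ℚ) ≤ n := by exact_mod_cast (by omega : 2 * d ≤ n)
        have h4 : (0 : ℚ) < (n + 1).choose d := by exact_mod_cast Nat.choose_pos (by omega)
        exact mul_pos (by linarith) h4
      rw [Nat.pos_iff_ne_zero]
      rintro h0
      rw [h0, Nat.cast_zero, mul_zero] at h1
      exact h2.ne h1
    obtain ⟨P⟩ := (Nat.card_pos_iff.1 hpos).1
    exact Module.End.hasEigenvalue_of_hasEigenvector (hvec d d le_rfl (by omega) P)
  · rw [finrank_eigenspace hu hd]
    have h1 := BallotPath.succ_mul_card (n := n) (d := d) (by omega)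
    have h2 : ((n - d + 1 - d : ℕ) : ℚ) = n - 2 * d + 1 := by
      have : ((n - d + 1 - d : ℕ) : ℚ) + 2 * d = n + 1 := by
        exact_mod_cast (by omega : n - d + 1 - d + 2 * d = n + 1)
      linarith
    have h3 : (n : ℚ) + 1 ≠ 0 := by positivity
    rw [Nat.cast_mul, h2]
    field_simp
    linear_combination (n - 2 * d + 1 : ℚ) * h1
  · rw [eigenspace_eigval hu hd]
    congr 1
    ext v
    constructor
    · rintro ⟨s, hds, hsd, P, rfl⟩
      exact ⟨(⟨s, hds, by omega⟩, P), rfl⟩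
    · rintro ⟨⟨⟨s, hs⟩, P⟩, rfl⟩
      have h2 : s ≤ n - d := hs.2
      exact ⟨s, hs.1, by omega, P, rfl⟩
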